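/- Let $N = 10$. For $k \ge 1$ let $G_k$ be the $N^k \times N^k$ grid: the nodes are the pairs $(i,j)$ with $0 \le i,j < N^k$, and two nodes are neighbors iff they agree in one coordinate and differ by exactly $1$ in the other. The network is asynchronous: neighbors exchange messages, the receiver knows which neighbor a message comes from, and every message between correct neighbors is eventually received, after an arbitrary delay. Byzantine nodes may send arbitrary messages to their neighbors at any time; the other nodes, called correct, follow the broadcast protocol $\mathrm{BP}_k$ defined below. A set $S$ of correct nodes is a *reliable node set* if in every execution and for all $s, r \in S$: (1) if $s$ broadcasts $m$, then $r$ eventually accepts $(s,m)$; (2) if $r$ accepts $(s,m)$, then $s$ has broadcast $m$. *Control Zone Protocol (CZP) on the $N \times N$ grid.* The border of a node $z$ is the set of nodes $v \ne z$ that differ from $z$ by at most $1$ in each coordinate. A node accepts $(u,m)$ when $u$ is itself and it broadcasts $m$; a node that receives $(s,m)$ from a neighbor $q$ accepts it if $q = s$, or as soon as it holds the authorization $(s,m,q)$. An accepted message is sent to all neighbors. A node that accepts $(s,m)$ from $q$ (or from itself, if it is the source) obtains the authorization $(s,m,z)$ for every $z \ne q$ whose border it belongs to. A node that holds $(s,m,z)$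 sends it to its neighbors in the border of $z$; a node of the border of $z$ obtains $(s,m,z)$ when it receives it from a node of the border of $z$. *The protocols $\mathrm{BP}_k$.* $\mathrm{BP}_1$ is the CZP on $G_1$. For a node $p = (i,j)$ of $G_k$, let the macro-node $G(p)$ be the $N \times N$ subgrid of $G_{k+1}$ whose node $(0,0)$ is $(Ni,Nj)$. In $\mathrm{BP}_{k+1}$, the CZP runs in every macro-node, and each node of $G(p)$ also runs the algorithm that $\mathrm{BP}_k$ gives to $p$, where: if that algorithm sends $x$ to a neighbor $q$ of $p$, the nodes of $G(p)$ that have a neighbor in $G(q)$ send $x$ to that neighbor; a node of $G(q)$ that receives $x$ from its neighbor in $G(p)$ broadcasts it (marked as coming from $p$) in $G(q)$ with the CZP; and a node of $G(q)$ considers that $q$ has received $x$ from $p$ when it has accepted, through the CZP in $G(q)$, such broadcasts of $x$ from strictly more than $N/2$ distinct nodes of $G(q)$ that have a neighbor in $G(p)$. To broadcast $m$ in $G_{k+1}$, a node $s$ of $G(p)$ broadcasts $(s,m)$ in $G(p)$ with the CZP; a node of $G(p)$ that accepts this broadcast from $s$ makes its simulated $p$ broadcast $(s,m)$ with $\mathrm{BP}_k$.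 A node accepts $(s,m)$ in $\mathrm{BP}_{k+1}$ when its simulated node of $G_k$ accepts that $p$ broadcast $(s,m)$, where $G(p)$ is the macro-node that contains $s$. **Theorem.** For every $k \ge 1$ and every set of at most $2^{k-1}$ Byzantine nodes of $G_k$, placed arbitrarily, there is a reliable node set $S$ for $\mathrm{BP}_k$ on $G_k$ that covers at least a $1 - \frac{4}{N^2}$ fraction of the grid: $$\frac{|S|}{N^{2k}} \;\ge\; 1 - \frac{4}{N^2}.$$ -/

import Mathlib

universe u

namespace GridBroadcast

/-! ### Grid networks -/

/-- A node is identified by its position on the grid. -/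
abbrev Node := ℕ × ℕ

/-- Position `v` belongs to the `L × L` grid. -/
def InGrid (L : ℕ) (v : Node) : Prop := v.1 < L ∧ v.2 < L

/-- Horizontal or vertical neighbors. -/
def Adj (a b : Node) : Prop :=
  (a.1 = b.1 ∧ (a.2 + 1 = b.2 ∨ b.2 + 1 = a.2)) ∨
  (a.2 = b.2 ∧ (a.1 + 1 = b.1 ∨ b.1 + 1 = a.1))

/-- The scale factor of the construction. -/
def N : ℕ := 10

/-- `G_k` is the `gridSide k × gridSide k` grid. -/
def gridSide (k : ℕ) : ℕ := N ^ k

/-! ### Message-passing protocols, executions, reliable node sets -/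

/-- What can happen at a node: it is asked to broadcast `m` (to the whole network), or it receives
the message `x` from its neighbor `q` (whose identity it knows). -/
inductive Input (M X : Type u) : Type u
  | bcast (m : M) : Input M X
  | recv (q : Node) (x : X) : Input M X

/-- A broadcast protocol for contents of type `M`. All algorithms considered are accumulative: the
local state of a node is the set `A` of inputs it has had so far, and this set determines
the messages sent so far (`(v, x) ∈ sends u A`: node `u` has sent `x` to `v`) and
the messages accepted so far (`(s, m) ∈ accepts u A`: node `u` has accepted that `s` broadcast
`m`). -/
structure Protocol (M : Type u) : Type (u + 1) where
  Msg : Type u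
  sends : Node → Set (Input M Msg) → Set (Node × Msg)
  accepts : Node → Set (Input M Msg) → Set (Node × M)

/-- The inputs of node `v` strictly before step `t`, when `ev t v` is the set of inputs of node `v`
at step `t`. -/
def stateAt {I : Type u} (ev : ℕ → Node → Set I) (t : ℕ) (v : Node) : Set I :=
  {i | ∃ t' < t, i ∈ ev t' v}

/-- `ev` is an asynchronous execution of the protocol `P` on the `L × L` grid, where the nodes in
`B` are Byzantine. Any number of events may take place in one step (the executions with one
event per step are a special case). Byzantine nodes may send anything to their
neighbors, at any time; correct nodes send exactly what the protocol prescribes; every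
message sent by a correct node to a correct neighbor is eventually received, after an arbitrary
delay. Broadcast requests are arbitrary. -/
structure IsExecution {M : Type u} (P : Protocol M) (L : ℕ) (B : Set Node)
    (ev : ℕ → Node → Set (Input M P.Msg)) : Prop where
  channel : ∀ t v q x, Input.recv q x ∈ ev t v → InGrid L q ∧ InGrid L v ∧ Adj q v
  sent : ∀ t v q x, Input.recv q x ∈ ev t v → q ∉ B → (v, x) ∈ P.sends q (stateAt ev t q)
  delivered : ∀ t v q x, InGrid L q → InGrid L v → Adj q v → q ∉ B → v ∉ B →
    (v, x) ∈ P.sends q (stateAt ev t q) → ∃ t', Input.recv q x ∈ ev t' v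

/-- `S` is a reliable node set for `P` on the `L × L` grid with Byzantine nodes `B`: it consists
of correct nodes and, in every execution, for all `s, r ∈ S`, if `s` broadcasts `m` then `r`
eventually accepts `(s, m)`, and if `r` accepts `(s, m)` then `s` did broadcast `m` before. -/
def IsReliable {M : Type u} (P : Protocol M) (L : ℕ) (B S : Set Node) : Prop :=
  (∀ v ∈ S, InGrid L v ∧ v ∉ B) ∧
  ∀ ev : ℕ → Node → Set (Input M P.Msg), IsExecution P L B ev →
    ∀ s ∈ S, ∀ r ∈ S, ∀ m : M,
      ((∃ t, Input.bcast m ∈ ev t s) → ∃ t, (s, m) ∈ P.accepts r (stateAt ev t r)) ∧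
      (∀ t, (s, m) ∈ P.accepts r (stateAt ev t r) → ∃ t' < t, Input.bcast m ∈ ev t' s)

/-! ### The Control Zone Protocol on the `N × N` grid

There is one control zone around each node `z`: its core is `{z}`, and its border, which cuts
the core from the rest of the grid, is the ring of the (at most eight) other nodes
at distance at most one from `z` in both coordinates. A message that claims a source outside the
core may leave the core only with an authorization; authorizations are issued by the border nodes
that the message reaches from outside the core, and travel along the border. -/

/-- The core of the control zone around `z`. -/
def core (z : Node) : Set Node := {z}

/-- The border of the control zone around `z`. -/
def border (z : Node) : Set Node :=
  {v | InGrid N z ∧ InGrid N v ∧ v ≠ z ∧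
    v.1 ≤ z.1 + 1 ∧ z.1 ≤ v.1 + 1 ∧ v.2 ≤ z.2 + 1 ∧ z.2 ≤ v.2 + 1}

/-- Messages of the Control Zone Protocol: `std s m` claims that `s` broadcast `m`, and
`auth s m z` is the authorization for `(s, m)` to leave the core of the zone `z`. -/
inductive CZMsg (M : Type u) : Type u
  | std (s : Node) (m : M) : CZMsg M
  | auth (s : Node) (m : M) (z : Node) : CZMsg M

/-- Facts in the memory of a node: `acc s m q` means that it has accepted `(s, m)` through
the node `q` (itself, if it is the source), `auth s m z` that it holds the authorization for
`(s, m)` to leave the core of `z`. -/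
inductive CZFact (M : Type u) : Type u
  | acc (s : Node) (m : M) (q : Node) : CZFact M
  | auth (s : Node) (m : M) (z : Node) : CZFact M

/-- The memory of node `u` after the inputs `A`. -/
inductive CZHolds {M : Type u} (u : Node) (A : Set (Input M (CZMsg M))) : CZFact M → Prop
  /-- A node accepts what it broadcasts itself. -/
  | own (m : M) : Input.bcast m ∈ A → CZHolds u A (.acc u m u)
  /-- A node accepts `(s, m)` from its neighbor `q` when it holds the authorizations required by
  all zones on whose border it lies and whose core contains `q` and not `s` (none, if `q = s`). -/
  | relay (s : Node) (m : M) (q : Node) : Input.recv q (CZMsg.std s m) ∈ A →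
      (∀ z, u ∈ border z → q ∈ core z → s ∉ core z → CZHolds u A (.auth s m z)) →
      CZHolds u A (.acc s m q)
  /-- A border node issues an authorization for what it accepts from outside the core. -/
  | grant (s : Node) (m : M) (q z : Node) : CZHolds u A (.acc s m q) →
      u ∈ border z → q ∉ core z → CZHolds u A (.auth s m z)
  /-- A border node adopts the authorizations received from the other border nodes. -/
  | spread (s : Node) (m : M) (q z : Node) : Input.recv q (CZMsg.auth s m z) ∈ A →
      q ∈ border z → u ∈ border z → CZHolds u A (.auth s m z)

/-- Messages sent by node `u` after the inputs `A`: all neighbors get the accepted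
messages, and the neighbors on the border of a zone get the authorizations for this zone. -/
inductive CZSends {M : Type u} (u : Node) (A : Set (Input M (CZMsg M))) :
    Node × CZMsg M → Prop
  | std (s : Node) (m : M) (q v : Node) : CZHolds u A (.acc s m q) →
      InGrid N v → Adj u v → CZSends u A (v, CZMsg.std s m)
  | auth (s : Node) (m : M) (z v : Node) : CZHolds u A (.auth s m z) →
      v ∈ border z → Adj u v → CZSends u A (v, CZMsg.auth s m z)

/-- The Control Zone Protocol on the `N × N` grid. -/
def czp (M : Type u) : Protocol M where
  Msg := CZMsg M
  sends u A := {p | CZSends u A p}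
  accepts u A := {p | ∃ q, CZHolds u A (.acc p.1 p.2 q)}

/-! ### From a protocol on `G_k` to a protocol on `G_{k+1}` -/

/-- The node `p` of `G_k` such that the node `v` of `G_{k+1}` is in the macro-node `G(p)`. -/
def mac (v : Node) : Node := (v.1 / N, v.2 / N)

/-- The position of `v` in its macro-node. -/
def loc (v : Node) : Node := (v.1 % N, v.2 % N)

/-- The node of `G_{k+1}` at position `a` of the macro-node `G(p)`. -/
def glob (p a : Node) : Node := (N * p.1 + a.1, N * p.2 + a.2)

/-- Positions in `G(q)` of the nodes of `G(q)` that have a neighbor in another macro-node `G(p)`. -/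
def macroBorder (p q : Node) : Set Node :=
  {a | p ≠ q ∧ InGrid N a ∧ ∃ w, Adj (glob q a) w ∧ mac w = p}

/-- Contents broadcast by the Control Zone Protocol inside a macro-node: `own m` is
broadcast by a node that wants to broadcast `m` in `G_{k+1}`, and `relay p x` by a node that
has received from its neighbor in the macro-node `G(p)` the macroscopic message `x`. -/
inductive LocalContent (M X : Type u) : Type u
  | own (m : M) : LocalContent M X
  | relay (p : Node) (x : X) : LocalContent M X

/-- Messages exchanged by the nodes of `G_{k+1}`: those of the Control Zone Protocol inside a
macro-node, and the macroscopic messages sent across the border of two macro-nodes. -/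
inductive MacroMsg (M X : Type u) : Type u
  | inner (c : CZMsg (LocalContent M X)) : MacroMsg M X
  | cross (x : X) : MacroMsg M X

section Lift

variable {M X : Type u}

/-- Inputs, at node `u` with inputs `A`, of the Control Zone Protocol run in the macro-node
of `u`. -/
inductive LocalInput (u : Node) (A : Set (Input M (MacroMsg M X))) :
    Input (LocalContent M X) (CZMsg (LocalContent M X)) → Prop
  | own (m : M) : Input.bcast m ∈ A → LocalInput u A (.bcast (.own m))
  | relay (q : Node) (x : X) : Input.recv q (MacroMsg.cross x) ∈ A → mac q ≠ mac u →
      LocalInput u A (.bcast (.relay (mac q) x))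
  | inner (q : Node) (c : CZMsg (LocalContent M X)) : Input.recv q (MacroMsg.inner c) ∈ A →
      mac q = mac u → LocalInput u A (.recv (loc q) c)

/-- Messages accepted by node `u` inside its macro-node. -/
def localAccepts (u : Node) (A : Set (Input M (MacroMsg M X))) : Set (Node × LocalContent M X) :=
  (czp (LocalContent M X)).accepts (loc u) {i | LocalInput u A i}

/-- Inputs, at node `u` with inputs `A`, of the algorithm of the node `mac u` of `G_k` that `u`
simulates. When `(s, m)` is accepted locally, where `s` is in the macro-node, the simulated node
broadcasts `(s, m)`; it receives `x` from `p` when strictly more than `N / 2` nodes of the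
macro-node that have a neighbor in `G(p)` are locally accepted as relaying `x`. -/
inductive MacroInput (u : Node) (A : Set (Input M (MacroMsg M X))) : Input (Node × M) X → Prop
  | bcast (a : Node) (m : M) : (a, LocalContent.own m) ∈ localAccepts u A →
      MacroInput u A (.bcast (glob (mac u) a, m))
  | recv (p : Node) (x : X) :
      N < 2 * {a | a ∈ macroBorder p (mac u) ∧
        (a, LocalContent.relay p x) ∈ localAccepts u A}.ncard →
      MacroInput u A (.recv p x)

end Lift

/-- The protocol on `G_{k+1}` obtained from a protocol `P` on `G_k`: each node `u` runs the
Control Zone Protocol in its macro-node and the algorithm that `P` gives to the node `mac u`,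
with the sends and receptions replaced by the macro-channels. It accepts that `s` broadcast `m`
when the simulated node accepts that `mac s` broadcast `(s, m)`. -/
def lift {M : Type u} (P : Protocol (Node × M)) : Protocol M where
  Msg := MacroMsg M P.Msg
  sends u A :=
    {y | ∃ v c, y = (v, MacroMsg.inner c) ∧ mac v = mac u ∧
        (loc v, c) ∈ (czp (LocalContent M P.Msg)).sends (loc u) {i | LocalInput u A i}} ∪
    {y | ∃ v x, y = (v, MacroMsg.cross x) ∧ Adj u v ∧ mac v ≠ mac u ∧
        (mac v, x) ∈ P.sends (mac u) {i | MacroInput u A i}}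
  accepts u A := {y | (mac y.1, y) ∈ P.accepts (mac u) {i | MacroInput u A i}}

/-- The broadcast protocol of `G_k`, for `k ≥ 1` (the value at `0` is not used). -/
def bp : ℕ → (M : Type u) → Protocol M
  | 0, M => czp M
  | 1, M => czp M
  | k + 2, M => lift (bp (k + 1) (Node × M))

end GridBroadcast

namespace GridBroadcast

/-! ### Connectivity of crosses in the plane -/

/-! The proof is an induction on the scale. On the `N × N` grid, let `z` be the only possible
Byzantine node. A forged message leaving `z` meets correct nodes of the border of `z`, which demand
an authorization; this authorization can only originate in a message that reached the border from
outside the core, so nothing forged in the name of a correct node is ever accepted (`czp_safe`). At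
distance at least two from `z`, the border of each zone is connected and entirely correct, so
authorizations circulate and messages flood the connected set of far nodes, then reach `relSet z`
(`czp_live`). The same flooding gives agreement, whatever the source: what one far node accepts, all
of `relSet z` accepts (`czp_agreement`).

At the next scale, a macro-node with at least two Byzantine nodes counts as Byzantine, which at
least halves their number; the others should behave as correct nodes of `G_k`. The difficulty is
that the simulations of one node need not have the same inputs. They are pooled into an ideal
execution on `G_k`. A message is received only with six relays, of which at most one is Byzantine
and at most three are fed from near the suspect of the sending macro-node; some relay is thus fed by
a far node (`exists_sender`). For safety, the pool contains the inputs of all correct simulations.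
For liveness, it keeps only those that all simulations in `relSet` eventually share: it loses no
input of a far node, by agreement, and the six good links given by `crossing_pairs` deliver all that
is sent from shared inputs.

At most four nodes per Byzantine node are lost in a macro-node that stays reliable. Charging each
Byzantine node once, either to a Byzantine macro-node or to a reliable one, gives the loss `4 * 50 ^
k * B.card` on `G_{k+1}`; with `2 ^ k` Byzantine nodes this is the fraction `4 / N ^ 2`. -/

theorem Adj.symm {a b : Node} (h : Adj a b) : Adj b a := by
  unfold Adj at *; omega

theorem interval_connected {Q : ℕ → Prop} {lo hi : ℕ}
    (h : ∀ c, lo ≤ c → c < hi → (Q c ↔ Q (c + 1))) {c d : ℕ}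
    (hc : lo ≤ c ∧ c ≤ hi) (hd : lo ≤ d ∧ d ≤ hi) (hQ : Q c) : Q d := by
  have key : ∀ n, lo + n ≤ hi → (Q lo ↔ Q (lo + n)) := by
    intro n
    induction n with
    | zero => intro _; rfl
    | succ n ih =>
      intro hn
      rw [ih (by omega), h (lo + n) (by omega) (by omega)]
      rfl
  have h1 := key (c - lo) (by omega)
  have h2 := key (d - lo) (by omega)
  rw [show lo + (c - lo) = c by omega] at h1
  rw [show lo + (d - lo) = d by omega] at h2
  exact h2.1 (h1.2 hQ)

/-- A union of rows and columns of a rectangle, with at least one of each, is connected. -/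
theorem cross_connected {Q : Node → Prop} {lo hi lo' hi' : ℕ} {R K : ℕ → Prop}
    (D : Node → Prop)
    (hD : ∀ i j, D (i, j) ↔ (lo ≤ i ∧ i ≤ hi) ∧ (lo' ≤ j ∧ j ≤ hi') ∧ (R i ∨ K j))
    (hR : ∃ i, (lo ≤ i ∧ i ≤ hi) ∧ R i) (hK : ∃ j, (lo' ≤ j ∧ j ≤ hi') ∧ K j)
    (step : ∀ x y, D x → D y → Adj x y → Q x → Q y) {x y : Node}
    (hx : D x) (hy : D y) (hQ : Q x) : Q y := by
  obtain ⟨i₀, hi₀, hRi⟩ := hR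
  obtain ⟨j₀, hj₀, hKj⟩ := hK
  have row : ∀ i, (lo ≤ i ∧ i ≤ hi) → R i → ∀ j j', (lo' ≤ j ∧ j ≤ hi') →
      (lo' ≤ j' ∧ j' ≤ hi') → Q (i, j) → Q (i, j') := by
    intro i hi hR j j' hj hj' h
    refine interval_connected (Q := fun c => Q (i, c)) (fun c h1 h2 => ?_) hj hj' h
    have hc : D (i, c) := (hD _ _).2 ⟨hi, ⟨h1, h2.le⟩, .inl hR⟩
    have hc' : D (i, c + 1) := (hD _ _).2 ⟨hi, ⟨by omega, h2⟩, .inl hR⟩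
    have ha : Adj (i, c) (i, c + 1) := .inl ⟨rfl, .inl rfl⟩
    exact ⟨step _ _ hc hc' ha, step _ _ hc' hc ha.symm⟩
  have col : ∀ j, (lo' ≤ j ∧ j ≤ hi') → K j → ∀ i i', (lo ≤ i ∧ i ≤ hi) →
      (lo ≤ i' ∧ i' ≤ hi) → Q (i, j) → Q (i', j) := by
    intro j hj hK i i' hi hi' h
    refine interval_connected (Q := fun c => Q (c, j)) (fun c h1 h2 => ?_) hi hi' h
    have hc : D (c, j) := (hD _ _).2 ⟨⟨h1, h2.le⟩, hj, .inr hK⟩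
    have hc' : D (c + 1, j) := (hD _ _).2 ⟨⟨by omega, h2⟩, hj, .inr hK⟩
    have ha : Adj (c, j) (c + 1, j) := .inr ⟨rfl, .inl rfl⟩
    exact ⟨step _ _ hc hc' ha, step _ _ hc' hc ha.symm⟩
  -- Any chosen row meets any chosen column, so everything connects to one fixed intersection.
  have hub : Q (i₀, j₀) := by
    obtain ⟨i, j⟩ := x
    obtain ⟨h1, h2, h3 | h3⟩ := (hD _ _).1 hx
    · exact col _ hj₀ hKj _ _ h1 hi₀ (row _ h1 h3 _ _ h2 hj₀ hQ)
    · exact row _ hi₀ hRi _ _ h2 hj₀ (col _ h2 h3 _ _ h1 hi₀ hQ)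
  obtain ⟨i, j⟩ := y
  obtain ⟨h1, h2, h3 | h3⟩ := (hD _ _).1 hy
  · exact row _ h1 h3 _ _ hj₀ h2 (col _ hj₀ hKj _ _ hi₀ h1 hub)
  · exact col _ h2 h3 _ _ hi₀ h1 (row _ hi₀ hRi _ _ hj₀ h2 hub)

/-- The border of a control zone is connected. -/
theorem border_connected {Q : Node → Prop} {v x y : Node}
    (step : ∀ x y, x ∈ border v → y ∈ border v → Adj x y → Q x → Q y)
    (hx : x ∈ border v) (hy : y ∈ border v) (hQ : Q x) : Q y := by
  have hv : InGrid N v := hx.1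
  -- The ring is the `3 × 3` window, clipped to the grid by truncated subtraction and `min 9`,
  -- without the crossing of the central row and column: a union of the other rows and columns.
  refine cross_connected (lo := v.1 - 1) (hi := min 9 (v.1 + 1)) (lo' := v.2 - 1)
    (hi' := min 9 (v.2 + 1)) (R := fun i => i ≠ v.1) (K := fun j => j ≠ v.2)
    (fun x => x ∈ border v) (fun i j => ?_) ?_ ?_ step hx hy hQ
  · obtain ⟨a, b⟩ := v
    simp only [border, InGrid, N, Set.mem_ofPred_eq, ne_eq, Prod.mk.injEq] at *
    omega
  · obtain ⟨a, b⟩ := v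
    simp only [InGrid, N] at *
    by_cases h : a = 0
    · exact ⟨1, by omega⟩
    · exact ⟨a - 1, by omega⟩
  · obtain ⟨a, b⟩ := v
    simp only [InGrid, N] at *
    by_cases h : b = 0
    · exact ⟨1, by omega⟩
    · exact ⟨b - 1, by omega⟩

/-- `v` is at distance at least two from `z` in some coordinate. -/
def Far (z v : Node) : Prop :=
  z.1 + 1 < v.1 ∨ v.1 + 1 < z.1 ∨ z.2 + 1 < v.2 ∨ v.2 + 1 < z.2

/-- The nodes of the `N × N` grid that are far from `z` form a connected set. -/
theorem far_connected {Q : Node → Prop} {z x y : Node}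
    (step : ∀ x y, InGrid N x ∧ Far z x → InGrid N y ∧ Far z y → Adj x y → Q x → Q y)
    (hx : InGrid N x ∧ Far z x) (hy : InGrid N y ∧ Far z y) (hQ : Q x) : Q y := by
  refine cross_connected (lo := 0) (hi := 9) (lo' := 0) (hi' := 9)
    (R := fun i => z.1 + 1 < i ∨ i + 1 < z.1) (K := fun j => z.2 + 1 < j ∨ j + 1 < z.2)
    (fun x => InGrid N x ∧ Far z x) (fun i j => ?_) ?_ ?_ step hx hy hQ
  · simp only [InGrid, Far, N]
    omega
  · by_cases h : z.1 < 5
    · exact ⟨9, by omega⟩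
    · exact ⟨0, by omega⟩
  · by_cases h : z.2 < 5
    · exact ⟨9, by omega⟩
    · exact ⟨0, by omega⟩

theorem mem_border_of_adj {u v : Node} (hu : InGrid N u) (hv : InGrid N v) (h : Adj u v) :
    v ∈ border u := by
  refine ⟨hu, hv, ?_, ?_⟩
  · rintro rfl
    unfold Adj at h; omega
  · unfold Adj at h; omega

theorem Far.ne_of_mem_border {z v x : Node} (h : Far z v) (hx : x ∈ border v) : x ≠ z := by
  rintro rfl
  obtain ⟨-, -, -, hx⟩ := hx
  unfold Far at h; omega

theorem Far.ne {z v : Node} (h : Far z v) : v ≠ z := by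
  rintro rfl
  unfold Far at h; omega

/-- When `v` gets a message from `u`, the node `y` gets it from `u` too, without passing through
`v`; it can therefore issue the authorization for the zone around `v`. -/
theorem exists_perpendicular {u v : Node} (hu : InGrid N u) (hv : InGrid N v) (h : Adj u v) :
    ∃ y, Adj u y ∧ y ∈ border v := by
  obtain ⟨a, b⟩ := u
  obtain ⟨c, d⟩ := v
  simp only [Adj, border, InGrid, N, Set.mem_ofPred_eq, ne_eq, Prod.mk.injEq, Prod.exists] at *
  rcases h with ⟨h1, h2⟩ | ⟨h1, h2⟩
  · by_cases h0 : a = 0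
    · exact ⟨1, b, by omega⟩
    · exact ⟨a - 1, b, by omega⟩
  · by_cases h0 : b = 0
    · exact ⟨a, 1, by omega⟩
    · exact ⟨a, b - 1, by omega⟩

/-- The nodes of the `N × N` grid with a neighbor far from `z`. -/
def relSet (z : Node) : Set Node :=
  {v | InGrid N v ∧ ∃ c, InGrid N c ∧ Far z c ∧ Adj c v}

theorem ne_of_mem_relSet {z v : Node} (h : v ∈ relSet z) : v ≠ z := by
  obtain ⟨hv, c, hc, hf, ha⟩ := h
  exact hf.ne_of_mem_border (mem_border_of_adj hc hv ha)

/-! ### Executions, safety and liveness -/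

/-- The requirements on executions that concern finite prefixes. -/
structure IsPreExecution {M : Type u} (P : Protocol M) (L : ℕ) (B : Set Node)
    (ev : ℕ → Node → Set (Input M P.Msg)) : Prop where
  channel : ∀ t v q x, Input.recv q x ∈ ev t v → InGrid L q ∧ InGrid L v ∧ Adj q v
  sent : ∀ t v q x, Input.recv q x ∈ ev t v → q ∉ B → (v, x) ∈ P.sends q (stateAt ev t q)

theorem IsExecution.toPre {M : Type u} {P : Protocol M} {L : ℕ} {B : Set Node}
    {ev : ℕ → Node → Set (Input M P.Msg)} (h : IsExecution P L B ev) :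
    IsPreExecution P L B ev := ⟨h.channel, h.sent⟩

/-- In all pre-executions, what the nodes of `S` accept from each other was broadcast before. -/
def IsSafe {M : Type u} (P : Protocol M) (L : ℕ) (B S : Set Node) : Prop :=
  ∀ ev : ℕ → Node → Set (Input M P.Msg), IsPreExecution P L B ev →
    ∀ s ∈ S, ∀ r ∈ S, ∀ (m : M) (t : ℕ),
      (s, m) ∈ P.accepts r (stateAt ev t r) → ∃ t' < t, Input.bcast m ∈ ev t' s

/-- In all executions, what a node of `S` broadcasts is eventually accepted by those of `S`. -/
def IsLive {M : Type u} (P : Protocol M) (L : ℕ) (B S : Set Node) : Prop :=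
  ∀ ev : ℕ → Node → Set (Input M P.Msg), IsExecution P L B ev →
    ∀ s ∈ S, ∀ r ∈ S, ∀ (m : M) (t : ℕ),
      Input.bcast m ∈ ev t s → ∃ t', (s, m) ∈ P.accepts r (stateAt ev t' r)

theorem stateAt_mono {I : Type u} (ev : ℕ → Node → Set I) {t t' : ℕ} (h : t ≤ t') (v : Node) :
    stateAt ev t v ⊆ stateAt ev t' v := by
  rintro i ⟨t₀, h₀, hi⟩
  exact ⟨t₀, h₀.trans_le h, hi⟩

/-! ### The Control Zone Protocol with at most one Byzantine node -/

section CZP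

variable {M : Type u}

theorem CZHolds.mono {u : Node} {A A' : Set (Input M (CZMsg M))} (h : A ⊆ A') {f : CZFact M}
    (hf : CZHolds u A f) : CZHolds u A' f := by
  induction hf with
  | own m hm => exact .own m (h hm)
  | relay s m q hr _ ih => exact .relay s m q (h hr) ih
  | grant s m q z _ hz hq ih => exact .grant s m q z ih hz hq
  | spread s m q z hr hq hu => exact .spread s m q z (h hr) hq hu

theorem czSends_std {u v s : Node} {m : M} {A : Set (Input M (CZMsg M))}
    (h : (v, CZMsg.std s m) ∈ (czp M).sends u A) : ∃ q, CZHolds u A (.acc s m q) := by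
  cases h with
  | std s m q v h _ _ => exact ⟨q, h⟩

theorem czSends_auth {u v s z : Node} {m : M} {A : Set (Input M (CZMsg M))}
    (h : (v, CZMsg.auth s m z) ∈ (czp M).sends u A) : CZHolds u A (.auth s m z) := by
  cases h with
  | auth s m z v h _ _ => exact h

variable {B : Set Node} {z : Node} {ev : ℕ → Node → Set (Input M (CZMsg M))}

/-- The invariant covers acceptances and the authorizations for the zone of `z` only: `z` can forge
those of other zones, but they never protect against `z`. The outer induction on time handles
receptions from correct nodes, the inner one the deductions made inside a node. -/
theorem czp_safe_fact (hB : ∀ v ∈ B, v = z)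
    (hev : IsPreExecution (czp M) N B ev) {s : Node} (hs : s ∉ B) (m : M) (t : ℕ) :
    ∀ u ∉ B, ∀ f : CZFact M, CZHolds u (stateAt ev t u) f →
      (f = .auth s m z ∨ ∃ q, f = .acc s m q) → ∃ t' < t, Input.bcast m ∈ ev t' s := by
  induction t using Nat.strong_induction_on with
  | _ t IH =>
  intro u hu f hf
  induction hf with
  | own m' hm =>
    rintro (h | ⟨q, h⟩)
    · cases h
    · cases h
      exact hm
  | relay s' m' q hr hz ih =>
    rintro (h | ⟨q, h⟩)
    · cases h
    · cases h
      obtain ⟨t', ht', hr⟩ := hr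
      -- A Byzantine sender is `z`, so the receiver holds the authorization for the zone of `z`,
      -- which the inner hypothesis covers.
      by_cases hq : q ∈ B
      · obtain ⟨h1, h2, h3⟩ := hev.channel _ _ _ _ hr
        refine ih q (mem_border_of_adj h1 h2 h3) rfl ?_ (.inl ?_)
        · rintro rfl
          exact hs hq
        · rw [hB q hq]
      · obtain ⟨q', hq'⟩ := czSends_std (hev.sent _ _ _ _ hr hq)
        obtain ⟨t'', h1, h2⟩ := IH t' ht' q hq _ hq' (.inr ⟨_, rfl⟩)
        exact ⟨t'', h1.trans ht', h2⟩
  | grant s' m' q z' _ hz' hq ih =>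
    rintro (h | ⟨q, h⟩)
    · cases h
      exact ih (.inr ⟨_, rfl⟩)
    · cases h
  | spread s' m' q z' hr hq hu' =>
    rintro (h | ⟨q, h⟩)
    · cases h
      obtain ⟨t', ht', hr⟩ := hr
      have hqB : q ∉ B := fun h => hq.2.2.1 (hB q h)
      obtain ⟨t'', h1, h2⟩ := IH t' ht' q hqB _ (czSends_auth (hev.sent _ _ _ _ hr hqB)) (.inl rfl)
      exact ⟨t'', h1.trans ht', h2⟩
    · cases h

/-- With at most one Byzantine node, the Control Zone Protocol is safe for all correct nodes. -/
theorem czp_safe (hB : ∀ v ∈ B, v = z) : IsSafe (czp M) N B Bᶜ := by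
  rintro ev hev s hs r hr m t ⟨q, hq⟩
  exact czp_safe_fact hB hev hs m t r hr _ hq (.inr ⟨_, rfl⟩)

theorem eventually_acc_of_adj (hev : IsExecution (czp M) N B ev) {s u v q : Node} {m : M}
    {t : ℕ} (h : CZHolds u (stateAt ev t u) (.acc s m q)) (hu : InGrid N u) (hv : InGrid N v)
    (hadj : Adj u v) (huB : u ∉ B) (hvB : v ∉ B)
    (hauth : s = u ∨ ∃ t, CZHolds v (stateAt ev t v) (.auth s m u)) :
    ∃ t, CZHolds v (stateAt ev t v) (.acc s m u) := by
  obtain ⟨t', ht'⟩ := hev.delivered t v u _ hu hv hadj huB hvB (CZSends.std s m q v h hv hadj)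
  obtain ⟨t'', h''⟩ : ∃ t'', s = u ∨ CZHolds v (stateAt ev t'' v) (.auth s m u) := by
    rcases hauth with h | ⟨t'', h⟩
    · exact ⟨0, .inl h⟩
    · exact ⟨t'', .inr h⟩
  refine ⟨max (t' + 1) t'', .relay s m u ⟨t', by omega, ht'⟩ fun z _ hz hs => ?_⟩
  obtain rfl : u = z := hz
  rcases h'' with h | h
  · exact absurd h hs
  · exact h.mono (stateAt_mono _ (by omega) _)

theorem eventually_auth_of_adj (hev : IsExecution (czp M) N B ev) {s u v z : Node} {m : M}
    {t : ℕ} (h : CZHolds u (stateAt ev t u) (.auth s m z)) (hu : u ∈ border z) (hv : v ∈ border z)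
    (hadj : Adj u v) (huB : u ∉ B) (hvB : v ∉ B) :
    ∃ t, CZHolds v (stateAt ev t v) (.auth s m z) := by
  obtain ⟨t', ht'⟩ := hev.delivered t v u _ hu.2.1 hv.2.1 hadj huB hvB
    (CZSends.auth s m z v h hv hadj)
  exact ⟨t' + 1, .spread s m u z ⟨t', by omega, ht'⟩ hu hv⟩

/-- All neighbors of `u` other than `z` eventually accept `(s, m)` from `u`. -/
def Flooded (z : Node) (ev : ℕ → Node → Set (Input M (CZMsg M))) (s : Node) (m : M)
    (u : Node) : Prop :=
  ∀ v, InGrid N v → Adj u v → v ≠ z → ∃ t, CZHolds v (stateAt ev t v) (.acc s m u)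

/-- The node `y` accepted the message from outside the core `{v}`, so it issues the authorization.
Since `v` is far from `z`, the border of `v` is correct and connected, and the authorization goes
all around it, to every neighbor of `v`. -/
theorem flooded_of_border (hB : ∀ v ∈ B, v = z) (hev : IsExecution (czp M) N B ev)
    {s v y q q' : Node} {m : M} {t t' : ℕ} (hf : Far z v)
    (hv : CZHolds v (stateAt ev t v) (.acc s m q)) (hy : y ∈ border v)
    (hyq : CZHolds y (stateAt ev t' y) (.acc s m q')) (hq' : q' ≠ v) :
    Flooded z ev s m v := by
  intro x hx hadj hxz
  have hbB : ∀ a ∈ border v, a ∉ B := fun a ha h => hf.ne_of_mem_border ha (hB a h)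
  have hxv : x ∈ border v := mem_border_of_adj hy.1 hx hadj
  refine eventually_acc_of_adj hev hv hy.1 hx hadj (fun h => hf.ne (hB v h)) (hbB x hxv)
    (.inr ?_)
  refine border_connected (Q := fun a => ∃ t, CZHolds a (stateAt ev t a) (.auth s m v))
    (fun a b ha hb hab hQ => ?_) hy hxv ⟨t', .grant s m q' v hyq hy hq'⟩
  obtain ⟨t, ht⟩ := hQ
  exact eventually_auth_of_adj hev ht ha hb hab (hbB a ha) (hbB b hb)

theorem Flooded.step (hB : ∀ v ∈ B, v = z) (hev : IsExecution (czp M) N B ev)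
    {s u v : Node} {m : M} (hfl : Flooded z ev s m u) (hu : InGrid N u) (hv : InGrid N v)
    (hf : Far z v) (hadj : Adj u v) : Flooded z ev s m v := by
  obtain ⟨t, ht⟩ := hfl v hv hadj hf.ne
  obtain ⟨y, huy, hy⟩ := exists_perpendicular hu hv hadj
  obtain ⟨t', ht'⟩ := hfl y hy.2.1 huy (hf.ne_of_mem_border hy)
  refine flooded_of_border hB hev hf ht hy ht' ?_
  rintro rfl
  unfold Adj at hadj; omega

theorem Flooded.accepts (hB : ∀ v ∈ B, v = z) (hev : IsExecution (czp M) N B ev)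
    {s u r : Node} {m : M} (hfl : Flooded z ev s m u) (hu : InGrid N u ∧ Far z u)
    (hr : r ∈ relSet z) : ∃ t, (s, m) ∈ (czp M).accepts r (stateAt ev t r) := by
  obtain ⟨hrN, c, hc, hfc, hadj⟩ := hr
  have hcfl : Flooded z ev s m c :=
    far_connected (Q := Flooded z ev s m)
      (fun x y hx hy hxy h => h.step hB hev hx.1 hy.1 hy.2 hxy) hu ⟨hc, hfc⟩ hfl
  obtain ⟨t, ht⟩ := hcfl r hrN hadj (ne_of_mem_relSet ⟨hrN, c, hc, hfc, hadj⟩)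
  exact ⟨t, c, ht⟩

theorem flooded_source (hB : ∀ v ∈ B, v = z) (hev : IsExecution (czp M) N B ev)
    {s : Node} {m : M} {t : ℕ} (hs : InGrid N s) (hsz : s ≠ z)
    (h : CZHolds s (stateAt ev t s) (.acc s m s)) : Flooded z ev s m s := fun v hv hadj hvz =>
  eventually_acc_of_adj hev h hs hv hadj (fun h => hsz (hB s h)) (fun h => hvz (hB v h)) (.inl rfl)

/-- With at most one Byzantine node, what a node of `relSet` broadcasts is eventually accepted by
all nodes of `relSet`. -/
theorem czp_live (hB : ∀ v ∈ B, v = z) : IsLive (czp M) N B (relSet z) := by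
  intro ev hev s hs r hr m t hm
  have hfl : Flooded z ev s m s :=
    flooded_source hB hev hs.1 (ne_of_mem_relSet hs) (.own m ⟨t, t.lt_succ_self, hm⟩)
  obtain ⟨hsN, c, hc, hf, hadj⟩ := hs
  exact (hfl.step hB hev hsN hc hf hadj.symm).accepts hB hev ⟨hc, hf⟩ hr

/-- With at most one Byzantine node, what a node far from it accepts, from any source, is
eventually accepted by all nodes of `relSet`. -/
theorem czp_agreement (hB : ∀ v ∈ B, v = z) (hev : IsExecution (czp M) N B ev)
    {s w r : Node} {m : M} {t : ℕ} (hw : InGrid N w) (hf : Far z w) (hr : r ∈ relSet z)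
    (h : (s, m) ∈ (czp M).accepts w (stateAt ev t w)) :
    ∃ t, (s, m) ∈ (czp M).accepts r (stateAt ev t r) := by
  classical
  -- The earliest acceptance by `w` is considered, so that the message cannot have come to `q` from
  -- `w` itself.
  have hex : ∃ t, ∃ q, CZHolds w (stateAt ev t w) (.acc s m q) := ⟨t, h⟩
  obtain ⟨q, hq⟩ := Nat.find_spec hex
  have hmin : ∀ t < Nat.find hex, ∀ q, ¬ CZHolds w (stateAt ev t w) (.acc s m q) :=
    fun t ht q hq => Nat.find_min hex ht ⟨q, hq⟩
  generalize Nat.find hex = t₀ at hq hmin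
  have hwB : w ∉ B := fun h => hf.ne (hB w h)
  suffices hfl : Flooded z ev s m w from hfl.accepts hB hev ⟨hw, hf⟩ hr
  cases hq with
  | own _ hm => exact flooded_source hB hev hw hf.ne (.own m hm)
  | relay _ _ _ hr hz =>
    obtain ⟨t₁, ht₁, hr⟩ := hr
    obtain ⟨h1, h2, h3⟩ := hev.channel _ _ _ _ hr
    have hqw : q ∈ border w := mem_border_of_adj h2 h1 h3.symm
    have hqB : q ∉ B := fun h => hf.ne_of_mem_border hqw (hB q h)
    obtain ⟨q', hq'⟩ := czSends_std (hev.sent _ _ _ _ hr hqB)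
    -- It remains to see that `q` did not accept from `w`: otherwise `w`, being correct, would have
    -- accepted before sending, contradicting minimality.
    refine flooded_of_border hB hev hf (.relay s m q ⟨t₁, ht₁, hr⟩ hz) hqw hq' ?_
    rintro rfl
    cases hq' with
    | own _ _ => exact hqw.2.2.1 rfl
    | relay _ _ _ hr' _ =>
      obtain ⟨t₂, ht₂, hr'⟩ := hr'
      obtain ⟨q'', hq''⟩ := czSends_std (hev.sent _ _ _ _ hr' hwB)
      exact hmin t₂ (ht₂.trans ht₁) q'' hq''

end CZP

/-! ### Finitary maps -/

/-- A monotone map between powersets whose values depend on finite subsets of the argument. -/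
structure Finitary {α β : Type*} (f : Set α → Set β) : Prop where
  mono : Monotone f
  exists_finite : ∀ A, ∀ y ∈ f A, ∃ F ⊆ A, F.Finite ∧ y ∈ f F

theorem Finitary.exists_finite_superset {α β : Type*} {f : Set α → Set β} (hf : Finitary f)
    {A : Set α} {G : Set β} (hG : G.Finite) (h : G ⊆ f A) :
    ∃ F ⊆ A, F.Finite ∧ G ⊆ f F := by
  choose! F hFA hFfin hyF using fun y hy => hf.exists_finite A y (h hy)
  refine ⟨⋃ y ∈ G, F y, Set.iUnion₂_subset hFA, hG.biUnion hFfin, fun y hy => ?_⟩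
  exact hf.mono (Set.subset_biUnion_of_mem hy) (hyF y hy)

theorem Finitary.comp {α β γ : Type*} {f : Set β → Set γ} {g : Set α → Set β}
    (hf : Finitary f) (hg : Finitary g) : Finitary fun A => f (g A) where
  mono _ _ h := hf.mono (hg.mono h)
  exists_finite A y hy := by
    obtain ⟨G, hG, hGfin, hyG⟩ := hf.exists_finite _ y hy
    obtain ⟨F, hF, hFfin, hGF⟩ := hg.exists_finite_superset hGfin hG
    exact ⟨F, hF, hFfin, hf.mono hGF hyG⟩

theorem exists_subset_of_finite {α : Type*} {g : ℕ → Set α} (hg : Monotone g) {G : Set α}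
    (hG : G.Finite) (h : ∀ i ∈ G, ∃ t, i ∈ g t) : ∃ t, G ⊆ g t := by
  choose! τ hτ using h
  obtain ⟨T, hT⟩ := (hG.image τ).bddAbove
  exact ⟨T, fun i hi => hg (hT (Set.mem_image_of_mem τ hi)) (hτ i hi)⟩

/-- The elements of an infinite `A` may arrive at unbounded times. A given output needs only
finitely many of them, hence appears at a finite time. -/
theorem Finitary.exists_time {α β : Type*} {f : Set α → Set β} (hf : Finitary f)
    {g : ℕ → Set α} (hg : Monotone g) {A : Set α} (h : ∀ i ∈ A, ∃ t, i ∈ g t) {y : β}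
    (hy : y ∈ f A) : ∃ t, y ∈ f (g t) := by
  obtain ⟨F, hF, hFfin, hyF⟩ := hf.exists_finite A y hy
  obtain ⟨t, ht⟩ := exists_subset_of_finite hg hFfin fun i hi => h i (hF hi)
  exact ⟨t, hf.mono ht hyF⟩

/-- All outputs of the protocol depend on finitely many inputs. -/
def Protocol.IsFinitary {M : Type u} (P : Protocol M) : Prop :=
  ∀ u, Finitary (P.sends u) ∧ Finitary (P.accepts u)

theorem finitary_czHolds {M : Type u} (u : Node) :
    Finitary fun A : Set (Input M (CZMsg M)) => {f | CZHolds u A f} where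
  mono _ _ h _ hf := CZHolds.mono h hf
  exists_finite A f hf := by
    change CZHolds u A f at hf
    change ∃ F ⊆ A, F.Finite ∧ CZHolds u F f
    induction hf with
    | own m hm =>
      exact ⟨{.bcast m}, by simpa using hm, Set.finite_singleton _, .own m rfl⟩
    | relay s m q hr _ ih =>
      -- A core is a singleton, so `z = q` is the only zone that can demand an authorization.
      by_cases h : u ∈ border q ∧ s ∉ core q
      · obtain ⟨F, hF, hfin, hh⟩ := ih q h.1 rfl h.2
        refine ⟨insert (.recv q (.std s m)) F, Set.insert_subset hr hF, hfin.insert _,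
          .relay s m q (Set.mem_insert _ _) fun z _ hq _ => ?_⟩
        obtain rfl : q = z := hq
        exact hh.mono (Set.subset_insert _ _)
      · refine ⟨{.recv q (.std s m)}, by simpa using hr, Set.finite_singleton _,
          .relay s m q rfl fun z hz hq hs => ?_⟩
        obtain rfl : q = z := hq
        exact absurd ⟨hz, hs⟩ h
    | grant s m q z _ hz hq ih =>
      obtain ⟨F, hF, hfin, hh⟩ := ih
      exact ⟨F, hF, hfin, .grant s m q z hh hz hq⟩
    | spread s m q z hr hq hu =>
      exact ⟨{.recv q (.auth s m z)}, by simpa using hr, Set.finite_singleton _,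
        .spread s m q z rfl hq hu⟩

theorem czp_isFinitary (M : Type u) : (czp M).IsFinitary := by
  intro u
  refine ⟨⟨?_, ?_⟩, ⟨?_, ?_⟩⟩
  · intro A A' h y hy
    cases hy with
    | std s m q v hh hv ha => exact .std s m q v (hh.mono h) hv ha
    | auth s m z v hh hv ha => exact .auth s m z v (hh.mono h) hv ha
  · intro A y hy
    cases hy with
    | std s m q v hh hv ha =>
      obtain ⟨F, hF, hfin, hh⟩ := (finitary_czHolds u).exists_finite A _ hh
      exact ⟨F, hF, hfin, .std s m q v hh hv ha⟩
    | auth s m z v hh hv ha =>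
      obtain ⟨F, hF, hfin, hh⟩ := (finitary_czHolds u).exists_finite A _ hh
      exact ⟨F, hF, hfin, .auth s m z v hh hv ha⟩
  · rintro A A' h y ⟨q, hq⟩
    exact ⟨q, hq.mono h⟩
  · rintro A y ⟨q, hq⟩
    obtain ⟨F, hF, hfin, hh⟩ := (finitary_czHolds u).exists_finite A _ hq
    exact ⟨F, hF, hfin, q, hh⟩

theorem finitary_localInput {M X : Type u} (u : Node) :
    Finitary fun A : Set (Input M (MacroMsg M X)) => {i | LocalInput u A i} where
  mono A A' h i hi := by
    cases hi with
    | own m hm => exact .own m (h hm)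
    | relay q x hr hq => exact .relay q x (h hr) hq
    | inner q c hr hq => exact .inner q c (h hr) hq
  exists_finite A i hi := by
    cases hi with
    | own m hm => exact ⟨{.bcast m}, by simpa using hm, Set.finite_singleton _, .own m rfl⟩
    | relay q x hr hq =>
      exact ⟨{.recv q (.cross x)}, by simpa using hr, Set.finite_singleton _, .relay q x rfl hq⟩
    | inner q c hr hq =>
      exact ⟨{.recv q (.inner c)}, by simpa using hr, Set.finite_singleton _, .inner q c rfl hq⟩

theorem finitary_localAccepts {M X : Type u} (u : Node) :
    Finitary fun A : Set (Input M (MacroMsg M X)) => localAccepts u A :=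
  (czp_isFinitary _ (loc u)).2.comp (finitary_localInput u)

theorem finite_inGrid (L : ℕ) : {a | InGrid L a}.Finite :=
  ((Set.finite_Iio L).prod (Set.finite_Iio L)).subset fun _ h => h

/-- `Set.ncard` vanishes on infinite sets, so comparing quorums by inclusion requires finiteness. -/
theorem finite_macroBorder_inter (p q : Node) (R : Node → Prop) :
    {a | a ∈ macroBorder p q ∧ R a}.Finite :=
  (finite_inGrid N).subset fun _ h => h.1.2.1

theorem finitary_macroInput {M X : Type u} (u : Node) :
    Finitary fun A : Set (Input M (MacroMsg M X)) => {i | MacroInput u A i} where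
  mono A A' h i hi := by
    cases hi with
    | bcast a m ha => exact .bcast a m ((finitary_localAccepts u).mono h ha)
    | recv p x hc =>
      refine .recv p x (hc.trans_le (Nat.mul_le_mul_left 2 (Set.ncard_le_ncard ?_
        (finite_macroBorder_inter _ _ _))))
      exact fun a ha => ⟨ha.1, (finitary_localAccepts u).mono h ha.2⟩
  exists_finite A i hi := by
    cases hi with
    | bcast a m ha =>
      obtain ⟨F, hF, hfin, hh⟩ := (finitary_localAccepts u).exists_finite A _ ha
      exact ⟨F, hF, hfin, .bcast a m hh⟩
    | recv p x hc =>
      obtain ⟨F, hF, hfin, hh⟩ := (finitary_localAccepts u).exists_finite_superset (A := A)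
        ((finite_macroBorder_inter p (mac u) fun a =>
          (a, LocalContent.relay p x) ∈ localAccepts u A).image
            fun a => (a, LocalContent.relay p x))
        (by rintro _ ⟨a, ha, rfl⟩; exact ha.2)
      refine ⟨F, hF, hfin, .recv p x (hc.trans_le (Nat.mul_le_mul_left 2 (Set.ncard_le_ncard ?_
        (finite_macroBorder_inter _ _ _))))⟩
      exact fun a ha => ⟨ha.1, hh ⟨a, ha, rfl⟩⟩

theorem lift_isFinitary {M : Type u} {P : Protocol (Node × M)} (hP : P.IsFinitary) :
    (lift P).IsFinitary := by
  intro u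
  have hc := (czp_isFinitary (LocalContent M P.Msg) (loc u)).1.comp
    (finitary_localInput (M := M) (X := P.Msg) u)
  have hs := (hP (mac u)).1.comp (finitary_macroInput (M := M) (X := P.Msg) u)
  have ha := (hP (mac u)).2.comp (finitary_macroInput (M := M) (X := P.Msg) u)
  refine ⟨⟨?_, ?_⟩, ⟨fun _ _ h _ hy => ha.mono h hy, fun A y hy => ha.exists_finite A _ hy⟩⟩
  · rintro A A' h y (⟨v, c, rfl, hv, hy⟩ | ⟨v, x, rfl, hadj, hv, hy⟩)
    · exact .inl ⟨v, c, rfl, hv, hc.mono h hy⟩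
    · exact .inr ⟨v, x, rfl, hadj, hv, hs.mono h hy⟩
  · rintro A y (⟨v, c, rfl, hv, hy⟩ | ⟨v, x, rfl, hadj, hv, hy⟩)
    · obtain ⟨F, hF, hfin, hh⟩ := hc.exists_finite A _ hy
      exact ⟨F, hF, hfin, .inl ⟨v, c, rfl, hv, hh⟩⟩
    · obtain ⟨F, hF, hfin, hh⟩ := hs.exists_finite A _ hy
      exact ⟨F, hF, hfin, .inr ⟨v, x, rfl, hadj, hv, hh⟩⟩

theorem bp_isFinitary : ∀ (k : ℕ) (M : Type u), (bp k M).IsFinitary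
  | 0, M => czp_isFinitary M
  | 1, M => czp_isFinitary M
  | k + 2, M => lift_isFinitary (bp_isFinitary (k + 1) (Node × M))

/-! ### Positions and macro-nodes -/

theorem glob_mac_loc (u : Node) : glob (mac u) (loc u) = u := by
  simp only [glob, mac, loc, Nat.div_add_mod]

theorem mac_glob (p : Node) {a : Node} (ha : InGrid N a) : mac (glob p a) = p := by
  obtain ⟨p, p'⟩ := p
  simp only [glob, mac, InGrid, N, Prod.mk.injEq] at *
  omega

theorem loc_glob (p : Node) {a : Node} (ha : InGrid N a) : loc (glob p a) = a := by
  obtain ⟨a, a'⟩ := a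
  simp only [glob, loc, InGrid, N, Prod.mk.injEq] at *
  omega

theorem inGrid_loc (u : Node) : InGrid N (loc u) := by
  simp only [loc, InGrid, N]
  omega

theorem inGrid_mac_iff {L : ℕ} {u : Node} : InGrid L (mac u) ↔ InGrid (N * L) u := by
  simp only [mac, InGrid, N]
  omega

theorem adj_loc_iff {u v : Node} (h : mac u = mac v) : Adj (loc u) (loc v) ↔ Adj u v := by
  simp only [mac, loc, Adj, N, Prod.mk.injEq] at *
  omega

theorem Adj.mac {u v : Node} (h : Adj u v) (hne : mac u ≠ mac v) :
    Adj (GridBroadcast.mac u) (GridBroadcast.mac v) := by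
  simp only [GridBroadcast.mac, Adj, N, ne_eq, Prod.mk.injEq] at *
  omega

/-- The source `a` of a locally accepted message is not known to lie in the `N × N` grid; here this
follows from `hs`. -/
theorem eq_loc_of_mac_glob {u a s : Node} (h : glob (mac u) a = s) (hs : mac s = mac u) :
    a = loc s := by
  subst h
  obtain ⟨a, a'⟩ := a
  simp only [glob, mac, loc, N, Prod.mk.injEq] at *
  omega

/-- Positions of `G(q)` with a neighbor in `G(p)` that is close to `z` in its macro-node: there
are at most three. -/
theorem ncard_near_le (p q z : Node) :
    {a | InGrid N a ∧ ∃ w, Adj w (glob q a) ∧ mac w = p ∧ p ≠ q ∧ ¬ Far z (loc w)}.ncard ≤ 3 := by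
  classical
  obtain ⟨F, hF, hsub⟩ : ∃ F : Finset Node, F.card ≤ 3 ∧
      {a | InGrid N a ∧ ∃ w, Adj w (glob q a) ∧ mac w = p ∧ p ≠ q ∧ ¬ Far z (loc w)} ⊆ F := by
    -- `e` is the fixed coordinate of the side of `G(q)` that faces `G(p)`. Along this side, being
    -- close to `z` leaves an interval of at most three positions.
    have side : ∀ i j : ℕ, ∃ e, (i < j → e = 0) ∧ (¬ i < j → e = 9) := fun i j => by
      by_cases h : i < j
      · exact ⟨0, fun _ => rfl, fun h' => absurd h h'⟩
      · exact ⟨9, fun h' => absurd h' h, fun _ => rfl⟩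
    by_cases h : p.1 = q.1
    · obtain ⟨e, he, he'⟩ := side p.2 q.2
      refine ⟨(Finset.Icc (z.1 - 1) (z.1 + 1)).image fun c => (c, e),
        Finset.card_image_le.trans (by simp; omega), ?_⟩
      rintro ⟨a, a'⟩ ⟨ha, ⟨w, w'⟩, hadj, rfl, hne, hf⟩
      obtain ⟨q, q'⟩ := q
      simp only [Finset.coe_image, Finset.coe_Icc, Set.mem_image, Set.mem_Icc, Prod.mk.injEq]
      simp only [glob, mac, loc, Far, Adj, InGrid, N, ne_eq, Prod.mk.injEq] at *
      refine ⟨a, ⟨?_, ?_⟩, rfl, ?_⟩ <;> omega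
    · obtain ⟨e, he, he'⟩ := side p.1 q.1
      refine ⟨(Finset.Icc (z.2 - 1) (z.2 + 1)).image fun c => (e, c),
        Finset.card_image_le.trans (by simp; omega), ?_⟩
      rintro ⟨a, a'⟩ ⟨ha, ⟨w, w'⟩, hadj, rfl, hne, hf⟩
      obtain ⟨q, q'⟩ := q
      simp only [Finset.coe_image, Finset.coe_Icc, Set.mem_image, Set.mem_Icc, Prod.mk.injEq]
      simp only [glob, mac, loc, Far, Adj, InGrid, N, ne_eq, Prod.mk.injEq] at *
      refine ⟨a', ⟨?_, ?_⟩, ?_, rfl⟩ <;> omega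
  calc _ ≤ (F : Set Node).ncard := Set.ncard_le_ncard hsub F.finite_toSet
    _ ≤ 3 := by rwa [Set.ncard_coe_finset]

/-! ### Counting the nodes of `relSet` -/

instance (z v : Node) : Decidable (Far z v) := by unfold Far; infer_instance

instance (L : ℕ) (v : Node) : Decidable (InGrid L v) := by unfold InGrid; infer_instance

instance (a b : Node) : Decidable (Adj a b) := by unfold Adj; infer_instance

/-- The four candidate neighbors of a node (with repetitions on the axes). -/
def around (v : Node) : List Node :=
  [(v.1 + 1, v.2), (v.1 - 1, v.2), (v.1, v.2 + 1), (v.1, v.2 - 1)]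

theorem mem_relSet_iff {z v : Node} :
    v ∈ relSet z ↔ InGrid N v ∧ ∃ c ∈ around v, InGrid N c ∧ Far z c ∧ Adj c v := by
  refine and_congr_right fun _ => exists_congr fun c => ?_
  refine ⟨fun h => ⟨?_, h⟩, fun h => h.2⟩
  obtain ⟨a, b⟩ := v
  obtain ⟨c, d⟩ := c
  have := h.2.2
  simp only [around, List.mem_cons, List.not_mem_nil, Prod.mk.injEq, Adj] at *
  omega

instance (z v : Node) : Decidable (v ∈ relSet z) := decidable_of_iff' _ mem_relSet_iff

/-- The node treated as Byzantine in a macro-node: a node of the `N × N` grid or, when all nodes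
are correct, a remote one. -/
def IsSuspect (z : Node) : Prop := InGrid N z ∨ z = (20, 20)

theorem IsSuspect.induction {Q : Node → Prop} (h : ∀ i < 10, ∀ j < 10, Q (i, j))
    (h' : Q (20, 20)) {z : Node} (hz : IsSuspect z) : Q z := by
  rcases hz with ⟨h1, h2⟩ | rfl
  · exact h _ h1 _ h2
  · exact h'

/-- The worst case is near a corner: for `z = (1, 1)`, the positions `(0, 0)` and `(0, 1)` are lost.
-/
theorem card_filter_row_le {z : Node} (hz : IsSuspect z) :
    ∀ e ∈ [0, 9], ((Finset.range 10).filter fun c => (e, c) ∉ relSet z).card ≤ 2 := by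
  refine IsSuspect.induction (Q := fun z => ∀ e ∈ [0, 9],
    ((Finset.range 10).filter fun c => (e, c) ∉ relSet z).card ≤ 2) ?_ ?_ hz
  · decide +kernel
  · decide +kernel

theorem card_filter_col_le {z : Node} (hz : IsSuspect z) :
    ∀ e ∈ [0, 9], ((Finset.range 10).filter fun c => (c, e) ∉ relSet z).card ≤ 2 := by
  refine IsSuspect.induction (Q := fun z => ∀ e ∈ [0, 9],
    ((Finset.range 10).filter fun c => (c, e) ∉ relSet z).card ≤ 2) ?_ ?_ hz
  · decide +kernel
  · decide +kernel

/-- This is the `4` of the final bound. It is attained at `z = (1, 1)`, which cuts off the `2 × 2`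
corner. -/
theorem card_filter_relSet_compl_le {z : Node} (hz : InGrid N z) :
    ((Finset.range 10 ×ˢ Finset.range 10).filter fun v => v ∉ relSet z).card ≤ 4 := by
  have h : ∀ i < 10, ∀ j < 10, ((Finset.range 10 ×ˢ Finset.range 10).filter
      fun v => v ∉ relSet (i, j)).card ≤ 4 := by decide +kernel
  exact h _ hz.1 _ hz.2

theorem card_filter_relSet_compl_remote :
    ((Finset.range 10 ×ˢ Finset.range 10).filter fun v => v ∉ relSet (20, 20)).card = 0 := by
  decide +kernel

theorem card_filter_and_ge {R R' : ℕ → Prop} [DecidablePred R] [DecidablePred R']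
    (h : ((Finset.range 10).filter fun c => ¬ R c).card ≤ 2)
    (h' : ((Finset.range 10).filter fun c => ¬ R' c).card ≤ 2) :
    6 ≤ ((Finset.range 10).filter fun c => R c ∧ R' c).card := by
  have h1 := Finset.card_filter_add_card_filter_not (s := Finset.range 10) fun c => R c ∧ R' c
  have h2 : ((Finset.range 10).filter fun c => ¬ (R c ∧ R' c)) ⊆
      ((Finset.range 10).filter fun c => ¬ R c) ∪ ((Finset.range 10).filter fun c => ¬ R' c) := by
    intro c
    simp only [Finset.mem_filter, Finset.mem_union]
    tauto
  have h3 := (Finset.card_le_card h2).trans (Finset.card_union_le _ _)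
  rw [Finset.card_range] at h1
  omega

/-- Two neighbor macro-nodes are connected by more than `N / 2` pairs of nodes of `relSet`. -/
theorem crossing_pairs {p q z z' : Node} (hpq : Adj p q) (hz : IsSuspect z)
    (hz' : IsSuspect z') :
    6 ≤ {a | a ∈ macroBorder p q ∧ a ∈ relSet z' ∧
      ∃ w, Adj w (glob q a) ∧ mac w = p ∧ loc w ∈ relSet z}.ncard := by
  -- `f` and `g` parametrize the facing sides of `G(q)` and `G(p)` so that `f c` and `g c` are
  -- linked. Each side loses at most two of its ten positions, so six links survive, just above `N /
  -- 2`.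
  have key : ∀ (f g : ℕ → Node), f.Injective →
      ((Finset.range 10).filter fun c => f c ∉ relSet z').card ≤ 2 →
      ((Finset.range 10).filter fun c => g c ∉ relSet z).card ≤ 2 →
      (∀ c < 10, p ≠ q ∧ InGrid N (f c) ∧ InGrid N (g c) ∧ Adj (glob p (g c)) (glob q (f c))) →
      6 ≤ {a | a ∈ macroBorder p q ∧ a ∈ relSet z' ∧
        ∃ w, Adj w (glob q a) ∧ mac w = p ∧ loc w ∈ relSet z}.ncard := by
    intro f g hf h1 h2 h
    refine (card_filter_and_ge h1 h2).trans ?_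
    rw [← Finset.card_image_of_injective _ hf, ← Set.ncard_coe_finset]
    refine Set.ncard_le_ncard ?_ (finite_macroBorder_inter _ _ _)
    intro a ha
    simp only [Finset.coe_image, Finset.coe_filter, Finset.mem_range, Set.mem_image] at ha
    obtain ⟨c, ⟨hc, hc1, hc2⟩, rfl⟩ := ha
    obtain ⟨hne, h3, h4, h5⟩ := h c hc
    refine ⟨⟨hne, h3, _, h5.symm, mac_glob _ h4⟩, hc1, _, h5, mac_glob _ h4, ?_⟩
    rwa [loc_glob _ h4]
  obtain ⟨p, p'⟩ := p
  obtain ⟨q, q'⟩ := q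
  have inj_row : ∀ e : ℕ, Function.Injective fun c : ℕ => (e, c) := fun e a b h => by
    simpa using h
  have inj_col : ∀ e : ℕ, Function.Injective fun c : ℕ => (c, e) := fun e a b h => by
    simpa using h
  rcases hpq with ⟨h1, h2 | h2⟩ | ⟨h1, h2 | h2⟩
  · refine key (fun c => (c, 0)) (fun c => (c, 9)) (inj_col 0)
      (card_filter_col_le hz' 0 (by simp)) (card_filter_col_le hz 9 (by simp)) fun c hc => ?_
    simp only [glob, Adj, InGrid, N, ne_eq, Prod.mk.injEq] at *
    omega
  · refine key (fun c => (c, 9)) (fun c => (c, 0)) (inj_col 9)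
      (card_filter_col_le hz' 9 (by simp)) (card_filter_col_le hz 0 (by simp)) fun c hc => ?_
    simp only [glob, Adj, InGrid, N, ne_eq, Prod.mk.injEq] at *
    omega
  · refine key (fun c => (0, c)) (fun c => (9, c)) (inj_row 0)
      (card_filter_row_le hz' 0 (by simp)) (card_filter_row_le hz 9 (by simp)) fun c hc => ?_
    simp only [glob, Adj, InGrid, N, ne_eq, Prod.mk.injEq] at *
    omega
  · refine key (fun c => (9, c)) (fun c => (0, c)) (inj_row 9)
      (card_filter_row_le hz' 9 (by simp)) (card_filter_row_le hz 0 (by simp)) fun c hc => ?_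
    simp only [glob, Adj, InGrid, N, ne_eq, Prod.mk.injEq] at *
    omega

/-! ### From `G_k` to `G_{k+1}` -/

section LiftProof

variable {M : Type u} {P : Protocol (Node × M)} {L : ℕ} {B B' : Set Node} {z : Node → Node}
  {ev : ℕ → Node → Set (Input M (MacroMsg M P.Msg))}

/-- The execution of the Control Zone Protocol in the macro-node `G(p)`. -/
def localEv {X : Type u} (p : Node) (ev : ℕ → Node → Set (Input M (MacroMsg M X))) (t : ℕ)
    (a : Node) : Set (Input (LocalContent M X) (czp (LocalContent M X)).Msg) :=
  {i | InGrid N a ∧ LocalInput (glob p a) (ev t (glob p a)) i}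

/-- The positions of the Byzantine nodes of `G(p)`. -/
def localByz (B : Set Node) (p : Node) : Set Node := {a | InGrid N a ∧ glob p a ∈ B}

theorem subset_stateAt {I : Type u} (ev : ℕ → Node → Set I) {t' t : ℕ} (h : t' < t) (v : Node) :
    ev t' v ⊆ stateAt ev t v := fun _ hi => ⟨t', h, hi⟩

/-- Each local input comes from a single input, so the passage to local inputs commutes with the
union over time. -/
theorem stateAt_localEv {X : Type u} {ev : ℕ → Node → Set (Input M (MacroMsg M X))} (t : ℕ)
    (u : Node) :
    stateAt (localEv (mac u) ev) t (loc u) = {i | LocalInput u (stateAt ev t u) i} := by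
  ext i
  constructor
  · rintro ⟨t', ht', -, hi⟩
    rw [glob_mac_loc] at hi
    exact (finitary_localInput u).mono (subset_stateAt ev ht' u) hi
  · intro hi
    suffices h : ∃ t' < t, LocalInput u (ev t' u) i by
      obtain ⟨t', ht', h⟩ := h
      exact ⟨t', ht', inGrid_loc u, by rwa [glob_mac_loc]⟩
    cases hi with
    | own m hm =>
      obtain ⟨t', ht', hm⟩ := hm
      exact ⟨t', ht', .own m hm⟩
    | relay q x hr hq =>
      obtain ⟨t', ht', hr⟩ := hr
      exact ⟨t', ht', .relay q x hr hq⟩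
    | inner q c hr hq =>
      obtain ⟨t', ht', hr⟩ := hr
      exact ⟨t', ht', .inner q c hr hq⟩

theorem localAccepts_eq {X : Type u} {ev : ℕ → Node → Set (Input M (MacroMsg M X))} (t : ℕ)
    (u : Node) :
    localAccepts u (stateAt ev t u) =
      (czp (LocalContent M X)).accepts (loc u) (stateAt (localEv (mac u) ev) t (loc u)) := by
  rw [stateAt_localEv, localAccepts]
  rfl

/-- Messages from other macro-nodes only become broadcast requests, which are unconstrained in an
execution. -/
theorem isPreExecution_localEv (hev : IsPreExecution (lift P) (N * L) B ev) (p : Node) :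
    IsPreExecution (czp (LocalContent M P.Msg)) N (localByz B p) (localEv p ev) where
  channel := by
    rintro t a _ c ⟨ha, hi⟩
    cases hi with
    | inner q c hr hq =>
      obtain ⟨-, -, h⟩ := hev.channel _ _ _ _ hr
      refine ⟨inGrid_loc q, ha, ?_⟩
      rw [← adj_loc_iff hq, loc_glob p ha] at h
      exact h
  sent := by
    rintro t a _ c ⟨ha, hi⟩ hB
    cases hi with
    | inner q c hr hq =>
      have hqp : mac q = p := hq.trans (mac_glob p ha)
      subst hqp
      have hqB : q ∉ B := fun h => hB ⟨inGrid_loc q, by rwa [glob_mac_loc]⟩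
      rw [stateAt_localEv]
      rcases hev.sent _ _ _ _ hr hqB with ⟨v, c', heq, -, h⟩ | ⟨v, x, heq, -⟩
      · cases heq
        rwa [loc_glob _ ha] at h
      · cases heq

theorem isExecution_localEv (hev : IsExecution (lift P) (N * L) B ev) {p : Node}
    (hp : InGrid L p) :
    IsExecution (czp (LocalContent M P.Msg)) N (localByz B p) (localEv p ev) where
  channel := (isPreExecution_localEv hev.toPre p).channel
  sent := (isPreExecution_localEv hev.toPre p).sent
  delivered := by
    intro t a b c hb ha hadj hbB haB h
    have hs := stateAt_localEv (ev := ev) t (glob p b)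
    rw [mac_glob p hb, loc_glob p hb] at hs
    rw [hs] at h
    have hmac : mac (glob p b) = mac (glob p a) := by rw [mac_glob p hb, mac_glob p ha]
    have hin : ∀ {d}, InGrid N d → InGrid (N * L) (glob p d) := fun hd =>
      inGrid_mac_iff.1 (by rwa [mac_glob p hd])
    obtain ⟨t', ht'⟩ := hev.delivered t (glob p a) (glob p b) (.inner c) (hin hb) (hin ha)
      (by rwa [← adj_loc_iff hmac, loc_glob p ha, loc_glob p hb])
      (fun h => hbB ⟨hb, h⟩) (fun h => haB ⟨ha, h⟩)
      (.inl ⟨glob p a, c, rfl, hmac.symm, by rwa [loc_glob p ha, loc_glob p hb]⟩)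
    have h2 := LocalInput.inner (u := glob p a) (glob p b) c ht' hmac
    rw [loc_glob p hb] at h2
    exact ⟨t', ha, h2⟩

/-- Outside `B'`, at most one node of the macro-node `G(p)` is Byzantine: the one at `z p`. -/
def Suspects (B B' : Set Node) (z : Node → Node) : Prop :=
  ∀ p, p ∉ B' → ∀ a ∈ localByz B p, a = z p


/-- What a correct node of a macro-node locally accepts from a correct node was broadcast. -/
theorem exists_bcast_of_localAccepts (hz : Suspects B B' z)
    (hev : IsPreExecution (lift P) (N * L) B ev)
    {u a : Node} (hu : mac u ∉ B') (huB : u ∉ B) (ha : glob (mac u) a ∉ B)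
    {t : ℕ} {c : LocalContent M P.Msg} (h : (a, c) ∈ localAccepts u (stateAt ev t u)) :
    ∃ t' < t, Input.bcast c ∈ localEv (mac u) ev t' a := by
  rw [localAccepts_eq] at h
  refine czp_safe (hz _ hu) _ (isPreExecution_localEv hev _) a (fun h' => ha h'.2) (loc u)
    (fun h' => huB ?_) c t h
  have := h'.2
  rwa [glob_mac_loc] at this

/-- A macroscopic message received by a correct node was sent by a node of the claimed
macro-node that is far from its suspect. -/
theorem exists_sender (hz : Suspects B B' z)
    (hev : IsPreExecution (lift P) (N * L) B ev)
    {u p : Node} (hu : mac u ∉ B') (huB : u ∉ B) {t : ℕ} {x : P.Msg}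
    (h : MacroInput u (stateAt ev t u) (.recv p x)) :
    ∃ t' < t, ∃ w v, mac w = p ∧ mac v = mac u ∧ mac w ≠ mac v ∧ Far (z p) (loc w) ∧
      Input.recv w (.cross x) ∈ ev t' v := by
  cases h with
  | recv _ _ hc =>
  by_contra hno
  -- If no far node had sent `x`, every accepted relay would be the suspect of the receiving
  -- macro-node or be fed by a node near the suspect of `G(p)`: at most `1 + 3` relays, short of the
  -- required six.
  have hsub : {a | a ∈ macroBorder p (mac u) ∧
      (a, LocalContent.relay p x) ∈ localAccepts u (stateAt ev t u)} ⊆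
      insert (z (mac u)) {a | InGrid N a ∧
        ∃ w, Adj w (glob (mac u) a) ∧ mac w = p ∧ p ≠ mac u ∧ ¬ Far (z p) (loc w)} := by
    rintro a ⟨⟨hne, ha, -⟩, hacc⟩
    by_cases haz : a = z (mac u)
    · exact .inl haz
    · have haB : glob (mac u) a ∉ B := fun h => haz (hz _ hu a ⟨ha, h⟩)
      obtain ⟨t', ht', -, hin⟩ := exists_bcast_of_localAccepts hz hev hu huB haB hacc
      cases hin with
      | relay w _ hr hw =>
        refine .inr ⟨ha, w, (hev.channel _ _ _ _ hr).2.2, rfl, hne, fun hf => hno ?_⟩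
        exact ⟨t', ht', w, _, rfl, mac_glob _ ha, hw, hf, hr⟩
  have hfin : {a | InGrid N a ∧ ∃ w, Adj w (glob (mac u) a) ∧ mac w = p ∧ p ≠ mac u ∧
      ¬ Far (z p) (loc w)}.Finite := (finite_inGrid N).subset fun _ h => h.1
  have h1 := (Set.ncard_le_ncard hsub (hfin.insert _)).trans (Set.ncard_insert_le _ _)
  have h2 := ncard_near_le p (mac u) (z p)
  simp only [N] at hc h1 h2
  omega

theorem not_mem_of_ne (hz : Suspects B B' z)
    {w : Node} (hp : mac w ∉ B') (hw : loc w ≠ z (mac w)) : w ∉ B := fun h =>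
  hw (hz _ hp _ ⟨inGrid_loc w, by rwa [glob_mac_loc]⟩)

/-- The inputs of the simulated nodes satisfy the requirements on pre-executions, when each
macro-node has some of the inputs of its correct nodes, as long as it has those of its nodes far
from the suspect. -/
theorem isPreExecution_macro (hz : Suspects B B' z)
    (hP : P.IsFinitary) (hev : IsPreExecution (lift P) (N * L) B ev)
    {ev' : ℕ → Node → Set (Input (Node × M) P.Msg)}
    (hsub : ∀ t q i, i ∈ ev' t q →
      q ∉ B' ∧ ∃ u, mac u = q ∧ u ∉ B ∧ MacroInput u (stateAt ev t u) i)
    (hsup : ∀ t w i, InGrid L (mac w) → mac w ∉ B' → w ∉ B → Far (z (mac w)) (loc w) →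
      MacroInput w (stateAt ev t w) i → i ∈ ev' t (mac w)) :
    IsPreExecution P L B' ev' where
  channel := by
    intro t q p x h
    obtain ⟨hq, u, rfl, huB, h⟩ := hsub _ _ _ h
    obtain ⟨t', -, w, v, rfl, hv, hne, -, hr⟩ := exists_sender hz hev hq huB h
    obtain ⟨h1, h2, h3⟩ := hev.channel _ _ _ _ hr
    rw [← hv]
    exact ⟨inGrid_mac_iff.2 h1, inGrid_mac_iff.2 h2, h3.mac hne⟩
  sent := by
    intro t q p x h hp
    obtain ⟨hq, u, rfl, huB, h⟩ := hsub _ _ _ h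
    obtain ⟨t', ht', w, v, rfl, hv, hne, hf, hr⟩ := exists_sender hz hev hq huB h
    have hwB : w ∉ B := not_mem_of_ne hz hp hf.ne
    rcases hev.sent _ _ _ _ hr hwB with ⟨v', c, heq, -⟩ | ⟨v', x', heq, -, -, h'⟩
    · cases heq
    · cases heq
      rw [← hv]
      have hL : InGrid L (mac w) := inGrid_mac_iff.2 (hev.channel _ _ _ _ hr).1
      -- The ideal node had at step `t'` all inputs of the far simulation `w`; by monotonicity of
      -- `P` it has also sent `x`.
      have hle : {i | MacroInput w (stateAt ev t' w) i} ⊆ stateAt ev' t (mac w) := fun i hi =>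
        ⟨t', ht', hsup _ _ _ hL hp hwB hf hi⟩
      exact (hP _).1.mono hle h'

/-- All correct simulations of a node are merged into one ideal node with the union of their inputs.
Delivery is not guaranteed for this union, which is why safety is stated for pre-executions. An
ideal broadcast of `(s, m)` comes from a local acceptance, which local safety traces back to `s`. -/
theorem lift_safe (hz : Suspects B B' z)
    (hP : P.IsFinitary) {S' : Set Node} (hS' : ∀ p ∈ S', p ∉ B')
    (hsafe : IsSafe P L B' S') :
    IsSafe (lift P) (N * L) B {v | mac v ∈ S' ∧ loc v ∈ relSet (z (mac v))} := by
  rintro ev hev s ⟨hs, hsz⟩ r ⟨hr, hrz⟩ m t hacc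
  have hsB : s ∉ B := not_mem_of_ne hz (hS' _ hs) (ne_of_mem_relSet hsz)
  have hrB : r ∉ B := not_mem_of_ne hz (hS' _ hr) (ne_of_mem_relSet hrz)
  let ev' : ℕ → Node → Set (Input (Node × M) P.Msg) := fun t q =>
    {i | q ∉ B' ∧ ∃ u, mac u = q ∧ u ∉ B ∧ MacroInput u (stateAt ev t u) i}
  have hev' : IsPreExecution P L B' ev' := isPreExecution_macro hz hP hev
    (fun t q i h => h) (fun t w i _ hw hwB _ h => ⟨hw, w, rfl, hwB, h⟩)
  -- The inputs accumulated strictly before `t` enter `ev'` at step `t`, hence the shift to `t + 1`;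
  -- it is regained when the broadcast is traced back to a strictly earlier step.
  have hle : {i | MacroInput r (stateAt ev t r) i} ⊆ stateAt ev' (t + 1) (mac r) := fun i hi =>
    ⟨t, t.lt_succ_self, hS' _ hr, r, rfl, hrB, hi⟩
  obtain ⟨t', ht', -, u, hu, huB, h⟩ := hsafe ev' hev' (mac s) hs (mac r) hr (s, m) (t + 1)
    ((hP _).2.mono hle hacc)
  generalize hi : (Input.bcast (s, m) : Input (Node × M) P.Msg) = i at h
  cases h with
  | recv p x _ => cases hi
  | bcast a m' h =>
    obtain ⟨h1, rfl⟩ : s = glob (mac u) a ∧ m = m' := by simpa using hi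
    have hsa : a = loc s := eq_loc_of_mac_glob h1.symm hu.symm
    subst hsa
    obtain ⟨t'', ht'', -, hin⟩ := exists_bcast_of_localAccepts hz hev (hu ▸ hS' _ hs) huB
      (h1 ▸ hsB) h
    cases hin with
    | own _ hm =>
      rw [← h1] at hm
      exact ⟨t'', by omega, hm⟩

/-! ### Agreed inputs and liveness -/

theorem monotone_macroInput (u : Node) :
    Monotone fun t => {i | MacroInput u (stateAt ev t u) i} := fun _ _ h =>
  (finitary_macroInput u).mono (stateAt_mono ev h u)

/-- The inputs that all simulations of `p` in `relSet` eventually have. -/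
def Agreed (z : Node → Node) (ev : ℕ → Node → Set (Input M (MacroMsg M P.Msg))) (p : Node) :
    Set (Input (Node × M) P.Msg) :=
  {i | ∀ u, mac u = p → loc u ∈ relSet (z p) → ∃ t, MacroInput u (stateAt ev t u) i}

theorem localAccepts_agreement (hz : Suspects B B' z)
    (hev : IsExecution (lift P) (N * L) B ev) {u w a : Node}
    (hL : InGrid L (mac w)) (hw : mac w ∉ B') (hf : Far (z (mac w)) (loc w))
    (hu : mac u = mac w) (hur : loc u ∈ relSet (z (mac w))) {t : ℕ}
    {c : LocalContent M P.Msg} (h : (a, c) ∈ localAccepts w (stateAt ev t w)) :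
    ∃ t, (a, c) ∈ localAccepts u (stateAt ev t u) := by
  simp only [localAccepts_eq, hu] at h ⊢
  exact czp_agreement (hz _ hw) (isExecution_localEv hev hL) (inGrid_loc w) hf hur h

theorem localAccepts_live (hz : Suspects B B' z)
    (hev : IsExecution (lift P) (N * L) B ev) {u a : Node}
    (hL : InGrid L (mac u)) (hu : mac u ∉ B') (hur : loc u ∈ relSet (z (mac u)))
    (ha : a ∈ relSet (z (mac u))) {t : ℕ} {c : LocalContent M P.Msg}
    (h : Input.bcast c ∈ localEv (mac u) ev t a) :
    ∃ t, (a, c) ∈ localAccepts u (stateAt ev t u) := by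
  simp only [localAccepts_eq]
  exact czp_live (hz _ hu) _ (isExecution_localEv hev hL) a ha (loc u) hur c t h

/-- The acceptances of the quorum may occur at different times; they are finitely many and never
lost, so at some time all hold. -/
theorem exists_macroInput_recv {u p : Node} {x : P.Msg} {G : Set Node}
    (hG : ∀ a ∈ G, a ∈ macroBorder p (mac u)) (hcard : N < 2 * G.ncard)
    (h : ∀ a ∈ G, ∃ t, (a, LocalContent.relay p x) ∈ localAccepts u (stateAt ev t u)) :
    ∃ t, MacroInput u (stateAt ev t u) (.recv p x) := by
  have hGfin : G.Finite := (finite_inGrid N).subset fun a ha => (hG a ha).2.1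
  obtain ⟨t, ht⟩ := exists_subset_of_finite
    (g := fun t => {a | (a, LocalContent.relay p x) ∈ localAccepts u (stateAt ev t u)})
    (fun t t' htt' a ha => (finitary_localAccepts u).mono (stateAt_mono ev htt' u) ha) hGfin h
  refine ⟨t, .recv p x (hcard.trans_le (Nat.mul_le_mul_left 2 (Set.ncard_le_ncard ?_
    (finite_macroBorder_inter _ _ _))))⟩
  exact fun a ha => ⟨hG a ha, ht ha⟩

/-- The inputs of a simulation by a node far from the suspect are agreed. -/
theorem mem_agreed (hz : Suspects B B' z)
    (hev : IsExecution (lift P) (N * L) B ev) {w : Node}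
    (hL : InGrid L (mac w)) (hw : mac w ∉ B') (hf : Far (z (mac w)) (loc w)) {t : ℕ}
    {i : Input (Node × M) P.Msg} (h : MacroInput w (stateAt ev t w) i) :
    i ∈ Agreed z ev (mac w) := by
  intro u hu hur
  cases h with
  | bcast a m h =>
    obtain ⟨t', h'⟩ := localAccepts_agreement hz hev hL hw hf hu hur h
    rw [← hu]
    exact ⟨t', .bcast a m h'⟩
  | recv p x hc =>
    refine exists_macroInput_recv (fun a ha => ?_) hc fun a ha =>
      localAccepts_agreement hz hev hL hw hf hu hur ha.2
    rw [hu]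
    exact ha.1

/-- Every node of `G(p)` at a `relSet` position eventually has the finitely many agreed inputs that
trigger `x`, and sends it. The links of `crossing_pairs` bring it to six `relSet` positions of
`G(q)`, whose relays all of `relSet` accepts by local liveness. -/
theorem recv_mem_agreed (hz : Suspects B B' z)
    (hP : P.IsFinitary) (hev : IsExecution (lift P) (N * L) B ev)
    (hsus : ∀ p, IsSuspect (z p)) {p q : Node} (hpL : InGrid L p) (hqL : InGrid L q)
    (hadj : Adj p q) (hp : p ∉ B') (hq : q ∉ B') {A : Set (Input (Node × M) P.Msg)}
    (hA : A ⊆ Agreed z ev p) {x : P.Msg} (hx : (q, x) ∈ P.sends p A) :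
    Input.recv p x ∈ Agreed z ev q := by
  rintro u rfl hur
  have hcard := crossing_pairs hadj (hsus p) (hsus (mac u))
  refine exists_macroInput_recv (fun a ha => ha.1)
    (lt_of_lt_of_le (by simp [N]) (Nat.mul_le_mul_left 2 hcard)) ?_
  rintro a ⟨⟨hne, haN, -⟩, har, w, hwadj, rfl, hwr⟩
  obtain ⟨t, ht⟩ := (hP (mac w)).1.exists_time (monotone_macroInput w)
    (fun i hi => hA hi w rfl hwr) hx
  have hmac : mac (glob (mac u) a) = mac u := mac_glob _ haN
  have haB : glob (mac u) a ∉ B := not_mem_of_ne hz (by rwa [hmac])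
    (by rw [hmac, loc_glob _ haN]; exact ne_of_mem_relSet har)
  obtain ⟨t', ht'⟩ := hev.delivered t (glob (mac u) a) w (.cross x) (inGrid_mac_iff.1 hpL)
    (inGrid_mac_iff.1 (by rwa [hmac])) hwadj (not_mem_of_ne hz hp (ne_of_mem_relSet hwr)) haB
    (.inr ⟨_, x, rfl, hwadj, by rw [hmac]; exact hne.symm, by rwa [hmac]⟩)
  exact localAccepts_live hz hev hqL hq hur har
    ⟨haN, .relay w x ht' (by rwa [hmac])⟩

/-- Restricting the merged inputs to the agreed ones makes delivery provable. The safety conditions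
survive since they only need the inputs of far nodes, all of which are agreed. What the ideal node
accepts from agreed inputs, every simulation in `relSet` eventually accepts. -/
theorem lift_live (hz : Suspects B B' z)
    (hP : P.IsFinitary) (hsus : ∀ p, IsSuspect (z p)) {S' : Set Node}
    (hS' : ∀ p ∈ S', InGrid L p ∧ p ∉ B') (hlive : IsLive P L B' S') :
    IsLive (lift P) (N * L) B {v | mac v ∈ S' ∧ loc v ∈ relSet (z (mac v))} := by
  rintro ev hev s ⟨hs, hsz⟩ r ⟨hr, hrz⟩ m t hm
  let ev' : ℕ → Node → Set (Input (Node × M) P.Msg) := fun t q =>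
    {i | (q ∉ B' ∧ ∃ u, mac u = q ∧ u ∉ B ∧ MacroInput u (stateAt ev t u) i) ∧
      i ∈ Agreed z ev q}
  have hpre : IsPreExecution P L B' ev' := isPreExecution_macro hz hP hev.toPre
    (fun t q i h => h.1)
    (fun t w i hL hw hwB hf h => ⟨⟨hw, w, rfl, hwB, h⟩, mem_agreed hz hev hL hw hf h⟩)
  have hstate : ∀ t q, stateAt ev' t q ⊆ Agreed z ev q := by
    rintro t q i ⟨t', -, -, hi⟩
    exact hi
  have hmem : ∀ {q i}, q ∉ B' → i ∈ Agreed z ev q → ∀ u, mac u = q → loc u ∈ relSet (z q) →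
      ∃ t, i ∈ ev' t q := by
    rintro q i hq hi u rfl hur
    obtain ⟨t, ht⟩ := hi u rfl hur
    exact ⟨t, ⟨hq, u, rfl, not_mem_of_ne hz hq (ne_of_mem_relSet hur), ht⟩, hi⟩
  have hex : IsExecution P L B' ev' := by
    refine ⟨hpre.channel, hpre.sent, fun t q p x hp hq hadj hpB hqB hx => ?_⟩
    have hag := recv_mem_agreed hz hP hev hsus hp hq hadj hpB hqB (hstate t p) hx
    -- Used only to find one position of `relSet (z q)`, whose simulation dates the delivery.
    have hcard := crossing_pairs hadj (hsus p) (hsus q)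
    obtain ⟨a, ⟨-, haN, -⟩, har, -⟩ := Set.nonempty_of_ncard_ne_zero
      (Nat.ne_of_gt (lt_of_lt_of_le (by norm_num) hcard))
    exact hmem hqB hag (glob q a) (mac_glob _ haN) (by rwa [loc_glob _ haN])
  have hag : Input.bcast (s, m) ∈ Agreed z ev (mac s) := by
    intro u hu hur
    obtain ⟨t', h⟩ := localAccepts_live (u := u) (a := loc s) (c := .own m) (t := t) hz hev
      (hu ▸ (hS' _ hs).1) (hu ▸ (hS' _ hs).2) (by rwa [hu]) (by rwa [hu])
      ⟨inGrid_loc s, by rw [hu, glob_mac_loc]; exact .own m hm⟩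
    have h' := MacroInput.bcast _ _ h
    rw [hu, glob_mac_loc] at h'
    exact ⟨t', h'⟩
  obtain ⟨t₁, h₁⟩ := hmem (hS' _ hs).2 hag s rfl hsz
  obtain ⟨t₂, h₂⟩ := hlive ev' hex (mac s) hs (mac r) hr (s, m) t₁ h₁
  exact (hP (mac r)).2.exists_time (monotone_macroInput r) (fun i hi => hstate _ _ hi r rfl hrz) h₂

end LiftProof

/-! ### Counting and the main induction -/

/-- The nodes of the `L × L` grid. -/
def gridFinset (L : ℕ) : Finset Node := Finset.range L ×ˢ Finset.range L

theorem mem_gridFinset {L : ℕ} {v : Node} : v ∈ gridFinset L ↔ InGrid L v := by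
  simp [gridFinset, InGrid]

/-- The suspect is any Byzantine position of the macro-node, or the remote `(20, 20)` if there is
none; nothing is then lost, so the loss is proportional to the number of Byzantine nodes. -/
theorem exists_suspects (B : Finset Node) : ∃ z : Node → Node,
    (∀ p, IsSuspect (z p)) ∧
    Suspects B {p | 2 ≤ (B.filter fun v => mac v = p).card} z ∧
    ∀ p, ((gridFinset N).filter fun a => a ∉ relSet (z p)).card ≤
      4 * (B.filter fun v => mac v = p).card := by
  classical
  have h : ∀ p : Node, ∃ y, IsSuspect y ∧
      (¬ 2 ≤ (B.filter fun v => mac v = p).card → ∀ a ∈ localByz B p, a = y) ∧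
      ((gridFinset N).filter fun a => a ∉ relSet y).card ≤
        4 * (B.filter fun v => mac v = p).card := by
    intro p
    by_cases hne : ∃ y, y ∈ localByz B p
    · obtain ⟨y, hy, hyB⟩ := hne
      have hmem : ∀ a, a ∈ localByz B p → glob p a ∈ B.filter fun v => mac v = p := fun a ha =>
        Finset.mem_filter.2 ⟨ha.2, mac_glob p ha.1⟩
      refine ⟨y, .inl hy, fun hlt a ha => ?_, ?_⟩
      · have h1 := Finset.card_le_one.1 (by omega) _ (hmem a ha) _ (hmem y ⟨hy, hyB⟩)
        rw [← loc_glob p ha.1, h1, loc_glob p hy]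
      · have h1 := Finset.card_pos.2 ⟨_, hmem y ⟨hy, hyB⟩⟩
        have h2 : ((gridFinset N).filter fun a => a ∉ relSet y).card ≤ 4 :=
          card_filter_relSet_compl_le hy
        omega
    · refine ⟨(20, 20), .inr rfl, fun _ a ha => absurd ⟨a, ha⟩ hne, ?_⟩
      have h2 : ((gridFinset N).filter fun a => a ∉ relSet (20, 20)).card = 0 :=
        card_filter_relSet_compl_remote
      omega
  choose z h1 h2 h3 using h
  exact ⟨z, h1, h2, h3⟩

/-- The nodes of a macro-node, counted by their positions. -/
theorem card_filter_mac_le {L : ℕ} (p : Node) (R : Node → Prop) [DecidablePred R] :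
    ((gridFinset (N * L)).filter fun v => R (loc v) ∧ mac v = p).card ≤
      ((gridFinset N).filter R).card := by
  refine Finset.card_le_card_of_injOn loc (fun v hv => ?_) fun v hv w hw h => ?_
  · have := (Finset.mem_filter.1 hv).2.1
    exact Finset.mem_filter.2 ⟨mem_gridFinset.2 (inGrid_loc v), this⟩
  · have h1 : mac v = p := (Finset.mem_filter.1 hv).2.2
    have h2 : mac w = p := (Finset.mem_filter.1 hw).2.2
    rw [← glob_mac_loc v, ← glob_mac_loc w, h1, h2, h]

/-- A macro-node outside `S'` is given up entirely, at the cost of `N ^ 2 = 100` nodes. -/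
theorem card_loss_le {L : ℕ} (S' : Finset Node) (hS' : ∀ p ∈ S', InGrid L p)
    (R : Node → Set Node) [∀ p, DecidablePred fun v => v ∈ R p] :
    ((gridFinset (N * L)).filter fun v => ¬ (mac v ∈ S' ∧ loc v ∈ R (mac v))).card ≤
      100 * ((gridFinset L).filter fun p => p ∉ S').card +
        ∑ p ∈ S', ((gridFinset N).filter fun a => a ∉ R p).card := by
  classical
  have hmaps : ∀ v ∈ (gridFinset (N * L)).filter fun v => ¬ (mac v ∈ S' ∧ loc v ∈ R (mac v)),
      mac v ∈ gridFinset L := fun v hv =>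
    mem_gridFinset.2 (inGrid_mac_iff.2 (mem_gridFinset.1 (Finset.mem_filter.1 hv).1))
  rw [Finset.card_eq_sum_card_fiberwise hmaps,
    ← Finset.sum_filter_add_sum_filter_not (gridFinset L) fun p => p ∉ S']
  refine Nat.add_le_add ?_ ?_
  · refine (Finset.sum_le_card_nsmul _ _ 100 fun p _ => ?_).trans_eq
      (by rw [smul_eq_mul, mul_comm])
    calc _ ≤ ((gridFinset (N * L)).filter fun v => True ∧ mac v = p).card := by
          refine Finset.card_le_card fun v hv => ?_
          simp only [Finset.mem_filter] at hv ⊢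
          exact ⟨hv.1.1, trivial, hv.2⟩
      _ ≤ ((gridFinset N).filter fun _ => True).card := card_filter_mac_le p fun _ => True
      _ ≤ 100 := by simp [gridFinset, N]
  · have hfilter : (gridFinset L).filter (fun p => ¬ p ∉ S') = S' := by
      ext p
      simp only [Finset.mem_filter, not_not, mem_gridFinset]
      exact ⟨fun h => h.2, fun h => ⟨hS' p h, h⟩⟩
    rw [hfilter]
    refine Finset.sum_le_sum fun p hp => ?_
    refine (Finset.card_le_card fun v hv => ?_).trans
      (card_filter_mac_le (L := L) p fun a => a ∉ R p)
    simp only [Finset.mem_filter] at hv ⊢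
    obtain ⟨⟨hv, h⟩, rfl⟩ := hv
    exact ⟨hv, fun h' => h ⟨hp, h'⟩, rfl⟩

theorem sum_card_fiber_le (B : Finset Node) (T : Finset Node) :
    ∑ p ∈ T, (B.filter fun v => mac v = p).card ≤ B.card := by
  classical
  rw [← Finset.card_biUnion]
  · exact Finset.card_le_card (Finset.biUnion_subset.2 fun p _ => Finset.filter_subset _ _)
  · intro p _ q _ hpq
    refine Finset.disjoint_left.2 fun v hv hv' => hpq ?_
    rw [← (Finset.mem_filter.1 hv).2, ← (Finset.mem_filter.1 hv').2]

/-- With at most `2 ^ k` Byzantine nodes on `G_{k+1}`, all but at most `4 * 50 ^ k` times their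
number of nodes form a safe and live set. -/
theorem exists_safe_live (k : ℕ) : ∀ (M : Type u) (B : Finset Node),
    (∀ v ∈ B, InGrid (gridSide (k + 1)) v) → B.card ≤ 2 ^ k →
    ∃ S : Finset Node, (∀ v ∈ S, InGrid (gridSide (k + 1)) v ∧ v ∉ B) ∧
      IsSafe (bp (k + 1) M) (gridSide (k + 1)) B S ∧
      IsLive (bp (k + 1) M) (gridSide (k + 1)) B S ∧
      ((gridFinset (gridSide (k + 1))).filter fun v => v ∉ S).card ≤ 4 * 50 ^ k * B.card := by
  classical
  induction k with
  | zero =>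
    intro M B hB hcard
    rw [zero_add, gridSide, pow_one] at *
    obtain ⟨z, hz, hloss⟩ : ∃ z, (∀ v ∈ (B : Set Node), v = z) ∧
        ((gridFinset N).filter fun a => a ∉ relSet z).card ≤ 4 * B.card := by
      rcases B.eq_empty_or_nonempty with rfl | ⟨b, hb⟩
      · exact ⟨(20, 20), by simp, card_filter_relSet_compl_remote.le⟩
      · refine ⟨b, fun v hv => Finset.card_le_one.1 (by simpa using hcard) v hv b hb, ?_⟩
        have h1 := Finset.card_pos.2 ⟨b, hb⟩
        have h2 : ((gridFinset N).filter fun a => a ∉ relSet b).card ≤ 4 :=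
          card_filter_relSet_compl_le (hB b hb)
        omega
    have hcoe : ((gridFinset N).filter (fun v => v ∈ relSet z) : Set Node) = relSet z := by
      ext v
      simp only [Finset.coe_filter, Set.mem_ofPred_eq, mem_gridFinset]
      exact ⟨fun h => h.2, fun h => ⟨h.1, h⟩⟩
    have hrel : ∀ v ∈ relSet z, v ∉ (B : Set Node) := fun v hv h => ne_of_mem_relSet hv (hz v h)
    refine ⟨(gridFinset N).filter fun v => v ∈ relSet z, fun v hv => ?_, ?_, ?_, ?_⟩
    · obtain ⟨h1, h2⟩ := Finset.mem_filter.1 hv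
      exact ⟨mem_gridFinset.1 h1, hrel v h2⟩
    · rw [hcoe]
      exact fun ev hev s hs r hr => czp_safe hz ev hev s (hrel s hs) r (hrel r hr)
    · rw [hcoe]
      exact czp_live hz
    · rw [pow_zero, mul_one]
      refine (Finset.card_le_card fun v hv => ?_).trans hloss
      simp only [Finset.mem_filter] at hv ⊢
      exact ⟨hv.1, fun h => hv.2 ⟨hv.1, h⟩⟩
  | succ k ih =>
    intro M B hB hcard
    obtain ⟨z, hsus, hz, hloss⟩ := exists_suspects B
    have hside : gridSide (k + 1 + 1) = N * gridSide (k + 1) := by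
      simp only [gridSide, pow_succ, mul_comm]
    rw [hside] at hB ⊢
    generalize gridSide (k + 1) = L at hB ih ⊢
    let B' : Finset Node := (gridFinset L).filter fun p => 2 ≤ (B.filter fun v => mac v = p).card
    have hB' : (B' : Set Node) = {p | 2 ≤ (B.filter fun v => mac v = p).card} := by
      ext p
      simp only [B', Finset.coe_filter, Set.mem_ofPred_eq, mem_gridFinset, and_iff_right_iff_imp]
      intro h
      obtain ⟨v, hv⟩ := Finset.card_pos.1 (by omega : 0 < (B.filter fun v => mac v = p).card)
      obtain ⟨hvB, rfl⟩ := Finset.mem_filter.1 hv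
      exact inGrid_mac_iff.2 (hB v hvB)
    rw [← hB'] at hz
    have hB'sum : B'.card * 2 ≤ ∑ p ∈ B', (B.filter fun v => mac v = p).card := by
      rw [← smul_eq_mul]
      exact Finset.card_nsmul_le_sum _ _ _ fun p hp => (Finset.mem_filter.1 hp).2
    obtain ⟨S', hS', hsafe, hlive, hcount⟩ := ih (Node × M) B'
      (fun p hp => mem_gridFinset.1 (Finset.mem_filter.1 hp).1) (by
        have := hB'sum.trans (sum_card_fiber_le B B')
        rw [pow_succ] at hcard
        omega)
    have hS'B : ∀ p ∈ (S' : Set Node), InGrid L p ∧ p ∉ (B' : Set Node) := hS'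
    have hP := bp_isFinitary (k + 1) (Node × M)
    have hcoe : ((gridFinset (N * L)).filter
        (fun v => mac v ∈ S' ∧ loc v ∈ relSet (z (mac v))) : Set Node) =
        {v | mac v ∈ (S' : Set Node) ∧ loc v ∈ relSet (z (mac v))} := by
      ext v
      simp only [Finset.coe_filter, Set.mem_ofPred_eq, mem_gridFinset, SetLike.mem_coe]
      exact ⟨fun h => h.2, fun h => ⟨inGrid_mac_iff.1 (hS' _ h.1).1, h⟩⟩
    refine ⟨(gridFinset (N * L)).filter fun v => mac v ∈ S' ∧ loc v ∈ relSet (z (mac v)),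
      fun v hv => ?_, ?_, ?_, ?_⟩
    · obtain ⟨h1, h2, h3⟩ := Finset.mem_filter.1 hv
      exact ⟨mem_gridFinset.1 h1, not_mem_of_ne hz (hS'B _ h2).2 (ne_of_mem_relSet h3)⟩
    · rw [hcoe]
      exact lift_safe hz hP (fun p hp => (hS'B p hp).2) hsafe
    · rw [hcoe]
      exact lift_live hz hP hsus hS'B hlive
    -- Disjointness lets each Byzantine node be charged once: at least two of them for each element
    -- of `B'`, and `σ` in the macro-nodes of `S'`, so that `2 * B'.card + σ ≤ B.card`.
    · have hdisj : Disjoint B' S' :=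
        Finset.disjoint_left.2 fun p hp hp' => (hS' p hp').2 hp
      have hsum := sum_card_fiber_le B (B' ∪ S')
      rw [Finset.sum_union hdisj] at hsum
      have h1 := card_loss_le S' (fun p hp => (hS' p hp).1) fun p => relSet (z p)
      have h2 : ∑ p ∈ S', ((gridFinset N).filter fun a => a ∉ relSet (z p)).card ≤
          4 * ∑ p ∈ S', (B.filter fun v => mac v = p).card := by
        rw [Finset.mul_sum]
        exact Finset.sum_le_sum fun p _ => hloss p
      have h3 : ((gridFinset (N * L)).filter fun v => v ∉ (gridFinset (N * L)).filter
          fun v => mac v ∈ S' ∧ loc v ∈ relSet (z (mac v))).card ≤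
          ((gridFinset (N * L)).filter
            fun v => ¬ (mac v ∈ S' ∧ loc v ∈ relSet (z (mac v)))).card := by
        refine Finset.card_le_card fun v hv => ?_
        simp only [Finset.mem_filter] at hv ⊢
        exact ⟨hv.1, fun h => hv.2 ⟨hv.1, h⟩⟩
      have h50 : 1 ≤ 50 ^ (k + 1) := Nat.one_le_pow _ _ (by norm_num)
      set σ := ∑ p ∈ S', (B.filter fun v => mac v = p).card
      calc _ ≤ 100 * (4 * 50 ^ k * B'.card) + 4 * σ := by omega
        -- The growth factor is `50 = 100 / 2`: areas grow by `100` and each Byzantine macro-node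
        -- absorbs two Byzantine nodes.
        _ ≤ 4 * 50 ^ (k + 1) * (B'.card * 2) + 4 * 50 ^ (k + 1) * σ := by
          refine add_le_add (le_of_eq (by ring)) (Nat.mul_le_mul_right _ (by omega))
        _ = 4 * 50 ^ (k + 1) * (B'.card * 2 + σ) := by ring
        _ ≤ 4 * 50 ^ (k + 1) * B.card := Nat.mul_le_mul_left _ (by omega)

end GridBroadcast

/-! ### The covered fraction -/

theorem mainTheorem2 (M : Type*) (k : ℕ) (hk : 1 ≤ k) (B : Finset GridBroadcast.Node)
    (hB : ∀ v ∈ B, GridBroadcast.InGrid (GridBroadcast.gridSide k) v)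
    (hcard : B.card ≤ 2 ^ (k - 1)) :
    ∃ S : Finset GridBroadcast.Node,
      GridBroadcast.IsReliable (GridBroadcast.bp k M) (GridBroadcast.gridSide k) B S ∧
      1 - 4 / (GridBroadcast.N : ℝ) ^ 2 ≤
        (S.card : ℝ) / (GridBroadcast.gridSide k : ℝ) ^ 2 := by
  obtain ⟨k, rfl⟩ : ∃ n, k = n + 1 := ⟨k - 1, by omega⟩
  rw [Nat.add_sub_cancel] at hcard
  obtain ⟨S, hS, hsafe, hlive, hcount⟩ := GridBroadcast.exists_safe_live k M B hB hcard
  refine ⟨S, ⟨hS, fun ev hev s hs r hr m => ⟨fun ⟨t, ht⟩ => hlive ev hev s hs r hr m t ht,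
    fun t ht => hsafe ev hev.toPre s hs r hr m t ht⟩⟩, ?_⟩
  have hpos : (0 : ℝ) < (GridBroadcast.gridSide (k + 1) : ℝ) ^ 2 := by
    simp [GridBroadcast.gridSide, GridBroadcast.N]
  have hgrid := Finset.card_filter_add_card_filter_not
    (s := GridBroadcast.gridFinset (GridBroadcast.gridSide (k + 1))) fun v => v ∈ S
  have hle : ((GridBroadcast.gridFinset (GridBroadcast.gridSide (k + 1))).filter
      fun v => v ∈ S).card ≤ S.card :=
    Finset.card_le_card fun v hv => (Finset.mem_filter.1 hv).2
  have hgridcard : (GridBroadcast.gridFinset (GridBroadcast.gridSide (k + 1))).card =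
      GridBroadcast.gridSide (k + 1) ^ 2 := by
    simp [GridBroadcast.gridFinset, sq]
  have hside : GridBroadcast.gridSide (k + 1) ^ 2 = 100 * 100 ^ k := by
    rw [GridBroadcast.gridSide, GridBroadcast.N, ← pow_mul, mul_comm (k + 1) 2, pow_mul,
      pow_succ]
    norm_num [mul_comm]
  -- The bound `2 ^ k` on the Byzantine nodes turns `50 ^ k` into `100 ^ k`, so the loss is a
  -- fraction `4 / 100` of the `100 * 100 ^ k` nodes at every scale.
  have hloss : 4 * 50 ^ k * B.card ≤ 4 * 100 ^ k := by
    calc 4 * 50 ^ k * B.card ≤ 4 * 50 ^ k * 2 ^ k := Nat.mul_le_mul_left _ hcard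
      _ = 4 * (50 * 2) ^ k := by rw [mul_pow, mul_assoc]
      _ = 4 * 100 ^ k := by norm_num
  have hmain : 100 * 100 ^ k ≤ S.card + 4 * 100 ^ k := by omega
  rw [le_div_iff₀ hpos]
  have hsideR : (GridBroadcast.gridSide (k + 1) : ℝ) ^ 2 = 100 * 100 ^ k := by
    exact_mod_cast hside
  have hmainR : (100 * 100 ^ k : ℝ) ≤ S.card + 4 * 100 ^ k := by exact_mod_cast hmain
  rw [hsideR]
  norm_num [GridBroadcast.N]
  linarith
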